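/- There is a universal constant $a$ with the following property. Let $n\ge 1$ and let $X=\mathbb{H}^n/\Gamma$ be a closed hyperbolic $n$-manifold, i.e. $\Gamma$ is a group acting isometrically, freely and properly discontinuously on hyperbolic space $\mathbb{H}^n$ with compact quotient; let $\pi:\mathbb{H}^n\to X$ be the projection. A geodesic $n$-simplex in $X$ is the image under $\pi$ of a nondegenerate geodesic $n$-simplex of $\mathbb{H}^n$ (its lift), its diameter is the diameter of the lift, and its interior is the image of the interior of the lift. Suppose that $T$ geodesic $n$-simplices $\Delta_1,\dots,\Delta_T$ cover $X$ and that each of them has diameter at most half the injectivity radius of $X$. Then $X$ has a geometric triangulation by at most $$T\cdot 2^{Tan^2}$$ geodesic $n$-simplices such that the interior of each $n$-simplex of the triangulation is either contained in, or disjoint from, the interior of each $\Delta_j$. Here a geometric triangulation of $X$ by $N$ simplices consists of a gluing of $N$ standard $n$-simplices (their facets are partitioned into pairs of distinct facets, and the two facets of every pair are identified by an affine bijection) and a homeomorphism from the resulting quotient space to $X$ that maps each of the $N$ simplices to a geodesically embedded $n$-simplex, namely as $\pi$ composed with the straight parametrization of a geodesic $n$-simplex of $\mathbb{H}^n$. 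-/

import Mathlib

open scoped ENNReal NNReal

noncomputable section

namespace Hyperbolic

/-! ### Hyperbolic space (hyperboloid model) -/

/-- Minkowski space `ℝ^{1,n}`: one time coordinate and `n` space coordinates. -/
abbrev Minkowski (n : ℕ) : Type := ℝ × EuclideanSpace ℝ (Fin n)

/-- The Lorentz form `x₀ y₀ - x₁ y₁ - ⋯ - xₙ yₙ`. -/
def lorentz {n : ℕ} (u v : Minkowski n) : ℝ := u.1 * v.1 - inner ℝ u.2 v.2

/-- Hyperbolic `n`-space `ℍⁿ`: the sheet `⟨x, x⟩ = 1`, `x₀ > 0` of the hyperboloid. -/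
@[ext] structure HSpace (n : ℕ) where
  val : Minkowski n
  lorentz_self : lorentz val val = 1
  time_pos : 0 < val.1

variable {n : ℕ}

theorem lorentz_comm (u v : Minkowski n) : lorentz u v = lorentz v u := by
  simp only [lorentz, real_inner_comm, mul_comm]

theorem lorentz_add_left (u v w : Minkowski n) :
    lorentz (u + v) w = lorentz u w + lorentz v w := by
  simp only [lorentz, Prod.fst_add, Prod.snd_add, inner_add_left]; ring

theorem lorentz_smul_left (c : ℝ) (u v : Minkowski n) :
    lorentz (c • u) v = c * lorentz u v := by
  simp only [lorentz, Prod.smul_fst, Prod.smul_snd, real_inner_smul_left, smul_eq_mul]; ring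

theorem lorentz_add_right (u v w : Minkowski n) :
    lorentz u (v + w) = lorentz u v + lorentz u w := by
  rw [lorentz_comm, lorentz_add_left, lorentz_comm v, lorentz_comm w]

theorem lorentz_smul_right (c : ℝ) (u v : Minkowski n) :
    lorentz u (c • v) = c * lorentz u v := by
  rw [lorentz_comm, lorentz_smul_left, lorentz_comm]

theorem lorentz_sum_left {ι : Type*} (s : Finset ι) (f : ι → Minkowski n) (v : Minkowski n) :
    lorentz (∑ i ∈ s, f i) v = ∑ i ∈ s, lorentz (f i) v := by
  classical
  induction s using Finset.induction_on with
  | empty => simp [lorentz]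
  | insert a s ha ih => rw [Finset.sum_insert ha, Finset.sum_insert ha, lorentz_add_left, ih]

theorem HSpace.time_sq (x : HSpace n) : x.val.1 ^ 2 = 1 + ‖x.val.2‖ ^ 2 := by
  have h := x.lorentz_self
  simp only [lorentz, real_inner_self_eq_norm_sq] at h
  linarith [sq x.val.1]

theorem HSpace.norm_lt_time (x : HSpace n) : ‖x.val.2‖ < x.val.1 := by
  have h := x.time_sq
  have h0 := x.time_pos
  nlinarith [norm_nonneg x.val.2]

theorem HSpace.one_le_lorentz (x y : HSpace n) : 1 ≤ lorentz x.val y.val := by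
  have hx := x.time_sq
  have hy := y.time_sq
  have hin : inner ℝ x.val.2 y.val.2 ≤ ‖x.val.2‖ * ‖y.val.2‖ := real_inner_le_norm _ _
  have hp := mul_pos x.time_pos y.time_pos
  have h1 : 1 + ‖x.val.2‖ * ‖y.val.2‖ ≤ x.val.1 * y.val.1 := by
    apply le_of_sq_le_sq _ hp.le
    rw [mul_pow, hx, hy]
    nlinarith [sq_nonneg (‖x.val.2‖ - ‖y.val.2‖)]
  simp only [lorentz]
  linarith

/-- The Lorentz form is negative definite on the orthogonal complement of a point of `ℍⁿ`. -/
theorem time_sq_mul_le_of_orthogonal (y : HSpace n) (u : Minkowski n)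
    (h : lorentz u y.val = 0) : u.1 ^ 2 * y.val.1 ^ 2 ≤ ‖u.2‖ ^ 2 * ‖y.val.2‖ ^ 2 := by
  have h1 : u.1 * y.val.1 = inner ℝ u.2 y.val.2 := by
    simp only [lorentz] at h; linarith
  rw [← mul_pow, ← mul_pow, h1]
  exact sq_le_sq.2 (by
    rw [abs_of_nonneg (by positivity : 0 ≤ ‖u.2‖ * ‖y.val.2‖)]
    exact abs_real_inner_le_norm _ _)

theorem lorentz_self_nonpos_of_orthogonal (y : HSpace n) (u : Minkowski n)
    (h : lorentz u y.val = 0) : lorentz u u ≤ 0 := by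
  have h1 := time_sq_mul_le_of_orthogonal y u h
  have hy := y.time_sq
  simp only [lorentz, real_inner_self_eq_norm_sq]
  by_contra! hc
  have h2 : ‖u.2‖ ^ 2 * y.val.1 ^ 2 < u.1 * u.1 * y.val.1 ^ 2 :=
    mul_lt_mul_of_pos_right (by linarith) (pow_pos y.time_pos 2)
  nlinarith [sq_nonneg ‖u.2‖]

theorem eq_zero_of_orthogonal (y : HSpace n) (u : Minkowski n)
    (h : lorentz u y.val = 0) (hu : lorentz u u = 0) : u = 0 := by
  have h1 := time_sq_mul_le_of_orthogonal y u h
  have hy := y.time_sq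
  simp only [lorentz, real_inner_self_eq_norm_sq] at hu
  have h2 : u.1 ^ 2 = ‖u.2‖ ^ 2 := by linarith [sq u.1]
  have h3 : ‖u.2‖ ^ 2 = 0 := by
    rw [h2, hy] at h1
    nlinarith [sq_nonneg ‖u.2‖]
  have h4 : u.2 = 0 := by simpa using h3
  have h5 : u.1 = 0 := by rw [h3] at h2; simpa using h2
  exact Prod.ext h5 h4

theorem lorentz_sq_le_of_orthogonal (y : HSpace n) (u w : Minkowski n)
    (hu : lorentz u y.val = 0) (hw : lorentz w y.val = 0) :
    lorentz u w ^ 2 ≤ lorentz u u * lorentz w w := by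
  have key : ∀ s : ℝ,
      0 ≤ (-lorentz w w) * (s * s) + (-(2 * lorentz u w)) * s + (-lorentz u u) := by
    intro s
    have := lorentz_self_nonpos_of_orthogonal y (u + s • w) (by
      rw [lorentz_add_left, lorentz_smul_left, hu, hw]; ring)
    simp only [lorentz_add_left, lorentz_add_right, lorentz_smul_left, lorentz_smul_right,
      lorentz_comm w u] at this
    linarith
  have := discrim_le_zero key
  simp only [discrim] at this
  nlinarith

theorem HSpace.lorentz_le_cosh_add (x y z : HSpace n) :
    lorentz x.val z.val ≤
      Real.cosh (Real.arcosh (lorentz x.val y.val) + Real.arcosh (lorentz y.val z.val)) := by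
  have h1 := x.one_le_lorentz y
  have h2 := y.one_le_lorentz z
  rw [Real.cosh_add, Real.cosh_arcosh h1, Real.cosh_arcosh h2, Real.sinh_arcosh h1,
    Real.sinh_arcosh h2]
  set p := lorentz x.val y.val with hp
  set q := lorentz y.val z.val with hq
  have hyx : lorentz y.val x.val = p := lorentz_comm _ _
  have hzy : lorentz z.val y.val = q := lorentz_comm _ _
  have hu : lorentz (x.val + (-p) • y.val) y.val = 0 := by
    rw [lorentz_add_left, lorentz_smul_left, y.lorentz_self, ← hp]; ring
  have hw : lorentz (z.val + (-q) • y.val) y.val = 0 := by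
    rw [lorentz_add_left, lorentz_smul_left, y.lorentz_self, hzy]; ring
  have hcs := lorentz_sq_le_of_orthogonal y _ _ hu hw
  simp only [lorentz_add_left, lorentz_add_right, lorentz_smul_left, lorentz_smul_right,
    x.lorentz_self, y.lorentz_self, z.lorentz_self, ← hp, ← hq, hyx, hzy] at hcs
  have h3 : lorentz x.val z.val - p * q ≤ √((p ^ 2 - 1) * (q ^ 2 - 1)) := by
    apply Real.le_sqrt_of_sq_le
    nlinarith
  rw [Real.sqrt_mul (by nlinarith)] at h3
  linarith

/-- The hyperbolic metric: `cosh d(x, y) = ⟨x, y⟩`. -/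
instance : MetricSpace (HSpace n) where
  dist x y := Real.arcosh (lorentz x.val y.val)
  dist_self x := by
    change Real.arcosh (lorentz x.val x.val) = 0
    rw [x.lorentz_self, Real.arcosh_zero]
  dist_comm x y := by
    change Real.arcosh (lorentz x.val y.val) = Real.arcosh (lorentz y.val x.val)
    rw [lorentz_comm]
  dist_triangle x y z := by
    change Real.arcosh (lorentz x.val z.val) ≤
      Real.arcosh (lorentz x.val y.val) + Real.arcosh (lorentz y.val z.val)
    have h0 : 0 ≤ Real.arcosh (lorentz x.val y.val) + Real.arcosh (lorentz y.val z.val) :=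
      add_nonneg (Real.arcosh_nonneg (x.one_le_lorentz y))
        (Real.arcosh_nonneg (y.one_le_lorentz z))
    have h := x.lorentz_le_cosh_add y z
    rw [← Real.arcosh_cosh h0]
    exact (Real.arcosh_le_arcosh (by linarith [x.one_le_lorentz z]) (Real.cosh_pos _)).2 h
  eq_of_dist_eq_zero := by
    intro x y h
    change Real.arcosh (lorentz x.val y.val) = 0 at h
    rw [Real.arcosh_eq_zero_iff (x.one_le_lorentz y)] at h
    have h1 : lorentz (x.val + (-1 : ℝ) • y.val) y.val = 0 := by
      rw [lorentz_add_left, lorentz_smul_left, y.lorentz_self, h]; ring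
    have h2 : lorentz (x.val + (-1 : ℝ) • y.val) (x.val + (-1 : ℝ) • y.val) = 0 := by
      simp only [lorentz_add_left, lorentz_add_right, lorentz_smul_left, lorentz_smul_right,
        x.lorentz_self, y.lorentz_self, lorentz_comm y.val x.val, h]
      ring
    have h3 := eq_zero_of_orthogonal y _ h1 h2
    apply HSpace.ext
    rwa [neg_one_smul, ← sub_eq_add_neg, sub_eq_zero] at h3

/-- The radial projection of a future timelike vector to `ℍⁿ`. -/
def normalize (u : Minkowski n) (h : 0 < lorentz u u) (h0 : 0 < u.1) : HSpace n where
  val := (√(lorentz u u))⁻¹ • u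
  lorentz_self := by
    rw [lorentz_smul_left, lorentz_smul_right, ← mul_assoc, ← mul_inv,
      Real.mul_self_sqrt h.le, inv_mul_cancel₀ h.ne']
  time_pos := by
    simp only [Prod.smul_fst, smul_eq_mul]
    exact mul_pos (inv_pos.2 (Real.sqrt_pos.2 h)) h0

/-! ### Geodesic simplices -/

/-- A (nondegenerate) geodesic `n`-simplex in `ℍⁿ`, given by its ordered vertices. -/
structure GeodesicSimplex (n : ℕ) where
  vertex : Fin (n + 1) → HSpace n
  linearIndependent : LinearIndependent ℝ fun k => (vertex k).val

namespace GeodesicSimplex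

/-- The linear combination of the vertices with the coefficients `t`. -/
def combination (Δ : GeodesicSimplex n) (t : stdSimplex ℝ (Fin (n + 1))) : Minkowski n :=
  ∑ k, t.1 k • (Δ.vertex k).val

theorem one_le_lorentz_combination (Δ : GeodesicSimplex n) (t : stdSimplex ℝ (Fin (n + 1)))
    (y : HSpace n) : 1 ≤ lorentz (Δ.combination t) y.val := by
  rw [combination, lorentz_sum_left, ← t.2.2]
  refine Finset.sum_le_sum fun k _ => ?_
  rw [lorentz_smul_left]
  exact le_mul_of_one_le_right (t.2.1 k) ((Δ.vertex k).one_le_lorentz y)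

theorem lorentz_combination_pos (Δ : GeodesicSimplex n) (t : stdSimplex ℝ (Fin (n + 1))) :
    0 < lorentz (Δ.combination t) (Δ.combination t) := by
  refine lt_of_lt_of_le one_pos ?_
  conv_rhs => rw [combination, lorentz_sum_left]
  rw [← t.2.2]
  refine Finset.sum_le_sum fun k _ => ?_
  rw [lorentz_smul_left, lorentz_comm]
  exact le_mul_of_one_le_right (t.2.1 k) (Δ.one_le_lorentz_combination t _)

theorem time_combination_pos (Δ : GeodesicSimplex n) (t : stdSimplex ℝ (Fin (n + 1))) :
    0 < (Δ.combination t).1 := by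
  have h := Δ.one_le_lorentz_combination t
    ⟨((1 : ℝ), 0), by simp [lorentz], by simp⟩
  simp only [lorentz, mul_one, inner_zero_right, sub_zero] at h
  linarith

/-- The straight parametrization `t ↦ ∑ tₖ vₖ / |∑ tₖ vₖ|` of a geodesic simplex by the standard
simplex; it maps every face of the standard simplex onto the geodesic convex hull of the
corresponding vertices, and it commutes with isometries of `ℍⁿ`. -/
def param (Δ : GeodesicSimplex n) (t : stdSimplex ℝ (Fin (n + 1))) : HSpace n :=
  normalize (Δ.combination t) (Δ.lorentz_combination_pos t) (Δ.time_combination_pos t)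

/-- The closed simplex, i.e. the geodesic convex hull of the vertices. -/
def carrier (Δ : GeodesicSimplex n) : Set (HSpace n) := Set.range Δ.param

/-- The interior of the simplex: the points all of whose barycentric coordinates are positive. -/
def openCarrier (Δ : GeodesicSimplex n) : Set (HSpace n) :=
  Δ.param '' {t | ∀ k, 0 < t.1 k}

end GeodesicSimplex

/-! ### Hyperbolic manifolds -/

section Manifold

variable (n : ℕ) (Γ : Type*) [Group Γ] [MulAction Γ (HSpace n)]

/-- The quotient `ℍⁿ / Γ`, with the quotient topology. It is a complete hyperbolic manifold when
`Γ` acts isometrically, freely and properly discontinuously. -/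
abbrev HypQuotient : Type _ := MulAction.orbitRel.Quotient Γ (HSpace n)

variable {n}

/-- The covering projection `ℍⁿ → ℍⁿ / Γ`. -/
def proj (x : HSpace n) : HypQuotient n Γ := Quotient.mk _ x

variable (n)

/-- The injectivity radius of `ℍⁿ / Γ`. At the image of `x`, the exponential map is the exponential
map of `ℍⁿ` at `x` followed by the projection, so it is injective on the ball of radius `r` of the
tangent space if and only if the projection is injective on the ball of radius `r` about `x`; the
injectivity radius at that point is the supremum of such `r`, and the injectivity radius of the
manifold is the infimum over all points. -/
def injectivityRadius : ℝ≥0∞ :=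
  ⨅ x : HSpace n, ⨆ (r : ℝ≥0) (_ : Set.InjOn (proj Γ) (Metric.ball x (r : ℝ))), (r : ℝ≥0∞)

end Manifold

/-! ### Gluings and geometric triangulations -/

/-- An `n`-dimensional gluing of `N` simplices. The facet opposite to vertex `k` of simplex `i` is
the pair `(i, k)`. It is paired with the facet `(adj (i, k), glue (i, k) k)`, by the affine
identification that sends vertex `m ≠ k` of simplex `i` to vertex `glue (i, k) m` of the other
simplex. Each facet lies in exactly one pair, and the two facets of a pair are distinct. -/
structure Gluing (n N : ℕ) where
  adj : Fin N × Fin (n + 1) → Fin N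
  glue : Fin N × Fin (n + 1) → Equiv.Perm (Fin (n + 1))
  mate_ne : ∀ f, (adj f, glue f f.2) ≠ f
  adj_mate : ∀ f, adj (adj f, glue f f.2) = f.1
  glue_mate : ∀ f, glue (adj f, glue f f.2) = (glue f)⁻¹

namespace Gluing

variable {N : ℕ} (G : Gluing n N)

/-- The point `p` lies on some facet, and `q` is its image under the identification of that facet
with its mate. -/
def Identified (p q : Fin N × stdSimplex ℝ (Fin (n + 1))) : Prop :=
  ∃ k, p.2.1 k = 0 ∧ q.1 = G.adj (p.1, k) ∧ ∀ m, q.2.1 (G.glue (p.1, k) m) = p.2.1 m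

/-- The quotient space of the disjoint union of `N` standard simplices by the equivalence relation
that the facet identifications generate. -/
abbrev Realization : Type := Quot G.Identified

end Gluing

/-- A geometric triangulation of `ℍⁿ / Γ` with `N` simplices of dimension `n`: a gluing with a
homeomorphism from its quotient space to `ℍⁿ / Γ`, under which every simplex of the gluing is
mapped to a geodesically embedded `n`-simplex (through its straight parametrization). -/
structure GeometricTriangulation (n : ℕ) (Γ : Type*) [Group Γ] [MulAction Γ (HSpace n)]
    (N : ℕ) where
  gluing : Gluing n N
  homeo : gluing.Realization ≃ₜ HypQuotient n Γ
  simplex : Fin N → GeodesicSimplex n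
  homeo_mk : ∀ i t, homeo (Quot.mk _ (i, t)) = proj Γ ((simplex i).param t)
  embedded : ∀ i, Set.InjOn (proj Γ) (simplex i).carrier

end Hyperbolic

end

/-! The triangulation is the barycentric subdivision, downstairs, of the arrangement formed by all
lifts of the `Δ j`. In the hyperboloid model a geodesic simplex is the section of a simplicial cone
in Minkowski space, cut out by the n + 1 coordinates of its vertex basis, and isometries are linear.
So the problem becomes one about a locally finite family of cones.

Two points lie in one cell when the same cones meet the cones containing them and the coordinates of
these nearby cones have the same signs. Only nearby cones are used: all the hyperplanes together
could be infinite in number near a point, while the injectivity radius bound lets at most one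
translate of each `Δ j` come near a given place. Cones that merely touch a cone through the point
must be included, so that passing to a face cannot enter a new cone unnoticed.

One centre is chosen in each cell, equivariantly (`SmallCover.isCentered`). Full flags of cells give
simplicial cones on their centres. A nonnegative combination of a flag determines its coefficients
and the vertices actually used (`Flag.comb_unique`); the flag cones cover (`exists_mem_cone`); each
facet has exactly two sides (`Flag.exists_mate`, `Flag.mate_unique`); and the flags around a point
are connected through facets containing it (`Flag.reflTransGen_step`). The last fact is what makes
the facet identifications alone generate every identification in the quotient, so the natural map
from the gluing is injective. It is a continuous bijection from a compact space to a Hausdorff one.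

For the count, a centre in a fixed translate is determined by which simplices contain it and by at
most T(n+1) signs, which leaves at most 2^T 3^(T(n+1)) centres and the (n+1)-th power of this many
flags. Each flag orbit has a representative inside some `Δ j`, which contributes the factor T. -/

noncomputable section
-- Cells of a family of cones, their faces and dimensions.
namespace Hyperbolic
open Topology

/-- A family of closed cones in `V`, each given by the linear coordinates that are nonnegative
on it. -/
structure ConeFamily (V Λ ι : Type*) [NormedAddCommGroup V] [NormedSpace ℝ V] where
  coord : Λ → ι → V →ₗ[ℝ] ℝ
  pointed : ∀ l v, (∀ k, coord l k v = 0) → v = 0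

namespace ConeFamily

variable {V Λ ι : Type*} [NormedAddCommGroup V] [NormedSpace ℝ V] (C : ConeFamily V Λ ι)

/-- The cones that contain `v`. -/
def support (v : V) : Set Λ := {l | ∀ k, 0 ≤ C.coord l k v}

/-- The cones that meet, outside the origin, one of the cones that contain `v`. -/
def near (v : V) : Set Λ :=
  {l | ∃ l' ∈ C.support v, ∃ w, w ≠ 0 ∧ l ∈ C.support w ∧ l' ∈ C.support w}

/-- `v` is a nonzero point of some cone. -/
def Covered (v : V) : Prop := v ≠ 0 ∧ (C.support v).Nonempty

/-- `w` lies in the closure of the cell of `v`, the cells being the sign classes of the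
coordinates of the cones near a point. -/
def FaceOf (w v : V) : Prop :=
  ∀ l ∈ C.near v, ∀ k, (C.coord l k v = 0 → C.coord l k w = 0) ∧
    (0 < C.coord l k v → 0 ≤ C.coord l k w) ∧ (C.coord l k v < 0 → C.coord l k w ≤ 0)

variable {C}

theorem support_subset_near {v : V} (hv : v ≠ 0) : C.support v ⊆ C.near v :=
  fun l hl => ⟨l, hl, v, hv, hl, hl⟩

theorem near_mono {v w : V} (h : C.support v ⊆ C.support w) : C.near v ⊆ C.near w :=
  fun _ ⟨l', hl', h'⟩ => ⟨l', h hl', h'⟩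

theorem FaceOf.refl (v : V) : C.FaceOf v v :=
  fun _ _ _ => ⟨id, le_of_lt, le_of_lt⟩

theorem FaceOf.zero (v : V) : C.FaceOf 0 v := fun _ _ _ => by simp

theorem FaceOf.support_subset {w v : V} (h : C.FaceOf w v) (hv : v ≠ 0) :
    C.support v ⊆ C.support w := by
  intro l hl k
  obtain ⟨h0, h1, -⟩ := h l (support_subset_near hv hl) k
  rcases (hl k).eq_or_lt with h' | h'
  · exact (h0 h'.symm).ge
  · exact h1 h'

theorem FaceOf.near_subset {w v : V} (h : C.FaceOf w v) (hv : v ≠ 0) : C.near v ⊆ C.near w :=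
  near_mono (h.support_subset hv)

theorem FaceOf.covered {w v : V} (h : C.FaceOf w v) (hv : C.Covered v) (hw : w ≠ 0) :
    C.Covered w := ⟨hw, hv.2.mono (h.support_subset hv.1)⟩

theorem FaceOf.trans {u w v : V} (h : C.FaceOf u w) (h' : C.FaceOf w v) (hv : v ≠ 0) :
    C.FaceOf u v := by
  intro l hl k
  obtain ⟨a0, a1, a2⟩ := h' l hl k
  obtain ⟨b0, b1, b2⟩ := h l (h'.near_subset hv hl) k
  refine ⟨fun hz => b0 (a0 hz), fun hz => ?_, fun hz => ?_⟩
  · rcases (a1 hz).eq_or_lt with h0 | h0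
    · exact (b0 h0.symm).ge
    · exact b1 h0
  · rcases (a2 hz).eq_or_lt with h0 | h0
    · exact (b0 h0).le
    · exact b2 h0

theorem FaceOf.smul {w v : V} (h : C.FaceOf w v) {c : ℝ} (hc : 0 ≤ c) : C.FaceOf (c • w) v := by
  intro l hl k
  obtain ⟨a0, a1, a2⟩ := h l hl k
  simp only [map_smul, smul_eq_mul]
  exact ⟨fun hz => by rw [a0 hz, mul_zero], fun hz => mul_nonneg hc (a1 hz),
    fun hz => mul_nonpos_of_nonneg_of_nonpos hc (a2 hz)⟩

theorem FaceOf.add {u w v : V} (h : C.FaceOf u v) (h' : C.FaceOf w v) : C.FaceOf (u + w) v := by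
  intro l hl k
  obtain ⟨a0, a1, a2⟩ := h l hl k
  obtain ⟨b0, b1, b2⟩ := h' l hl k
  simp only [map_add]
  exact ⟨fun hz => by rw [a0 hz, b0 hz, add_zero], fun hz => add_nonneg (a1 hz) (b1 hz),
    fun hz => add_nonpos (a2 hz) (b2 hz)⟩

theorem FaceOf.sum {α : Type*} {s : Finset α} {g : α → V} {v : V}
    (h : ∀ i ∈ s, C.FaceOf (g i) v) : C.FaceOf (∑ i ∈ s, g i) v := by
  classical
  induction s using Finset.induction_on with
  | empty => simpa using FaceOf.zero v
  | insert a s ha ih =>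
    rw [Finset.sum_insert ha]
    exact (h a (Finset.mem_insert_self _ _)).add
      (ih fun i hi => h i (Finset.mem_insert_of_mem hi))

/-- A face on which no further coordinate vanishes is the whole cell. The danger is a cone
containing `w` but not `v`: it meets at `w` a cone containing `v`, so it is near `v`, and its
coordinates that are negative at `v` would have to vanish at `w`. This is the reason for using
`near` and not only `support`. -/
theorem FaceOf.antisymm_of_zero {w v : V} (h : C.FaceOf w v) (hv : C.Covered v) (hw : w ≠ 0)
    (h0 : ∀ l ∈ C.near v, ∀ k, C.coord l k w = 0 → C.coord l k v = 0) : C.FaceOf v w := by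
  have hs : C.support w ⊆ C.support v := by
    intro l hl k
    obtain ⟨l', hl'⟩ := hv.2
    have hm : l ∈ C.near v := ⟨l', hl', w, hw, hl, h.support_subset hv.1 hl'⟩
    by_contra! hneg
    have := h0 l hm k (le_antisymm ((h l hm k).2.2 hneg) (hl k))
    exact hneg.ne this
  intro l hl k
  have hl' := near_mono hs hl
  obtain ⟨a0, a1, a2⟩ := h l hl' k
  refine ⟨h0 l hl' k, fun hz => ?_, fun hz => ?_⟩
  · by_contra! hneg
    exact absurd (a2 hneg) (not_le.2 hz)
  · by_contra! hneg
    exact absurd (a1 hneg) (not_le.2 hz)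

theorem ne_zero_of_coord {v u : V} (hv : C.Covered v)
    (h0 : ∀ l ∈ C.near v, ∀ k, C.coord l k u = 0 → C.coord l k v = 0) : u ≠ 0 := by
  rintro rfl
  obtain ⟨l, hl⟩ := hv.2
  exact hv.1 (C.pointed l v fun k => h0 l (support_subset_near hv.1 hl) k (map_zero _))

/-- Adding a point of the closed cell to a positive multiple of `v` does not leave the cell. -/
theorem FaceOf.smul_add {w v : V} (h : C.FaceOf w v) (hv : C.Covered v) {c : ℝ} (hc : 0 < c) :
    C.FaceOf (c • v + w) v ∧ C.FaceOf v (c • v + w) ∧ c • v + w ≠ 0 := by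
  have h1 : C.FaceOf (c • v + w) v := ((FaceOf.refl v).smul hc.le).add h
  have h0 : ∀ l ∈ C.near v, ∀ k, C.coord l k (c • v + w) = 0 → C.coord l k v = 0 := by
    intro l hl k hz
    obtain ⟨-, a1, a2⟩ := h l hl k
    simp only [map_add, map_smul, smul_eq_mul] at hz
    rcases lt_trichotomy (C.coord l k v) 0 with h' | h' | h'
    · nlinarith [a2 h']
    · exact h'
    · nlinarith [a1 h']
  have hne := ne_zero_of_coord hv h0
  exact ⟨h1, h1.antisymm_of_zero hv hne h0, hne⟩

variable (C) in
/-- The linear span of the cell of `v`. -/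
def cellSpan (v : V) : Submodule ℝ V where
  carrier := {u | ∀ l ∈ C.near v, ∀ k, C.coord l k v = 0 → C.coord l k u = 0}
  add_mem' ha hb l hl k hz := by rw [map_add, ha l hl k hz, hb l hl k hz, add_zero]
  zero_mem' _ _ _ _ := map_zero _
  smul_mem' c u hu l hl k hz := by rw [map_smul, hu l hl k hz, smul_zero]

variable (C) in
/-- The dimension of the cell of `v`, as a cone. -/
def rank (v : V) : ℕ := Module.finrank ℝ (C.cellSpan v)

theorem self_mem_cellSpan (v : V) : v ∈ C.cellSpan v := fun _ _ _ h => h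

theorem FaceOf.cellSpan_le {w v : V} (h : C.FaceOf w v) (hv : v ≠ 0) :
    C.cellSpan w ≤ C.cellSpan v :=
  fun _ hu l hl k hz => hu l (h.near_subset hv hl) k ((h l hl k).1 hz)

theorem rank_eq {w v : V} (h : C.FaceOf w v) (h' : C.FaceOf v w) (hv : v ≠ 0) (hw : w ≠ 0) :
    C.rank w = C.rank v := by
  rw [rank, rank, le_antisymm (h.cellSpan_le hv) (h'.cellSpan_le hw)]

/-- The ray from an interior point of a cell leaves the cell at a proper face. -/
theorem exists_sub_smul [Finite ι] {v y : V} (hv : C.Covered v) (hfin : (C.near v).Finite)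
    (h : C.FaceOf y v) (h' : C.FaceOf v y) :
    ∃ t : ℝ, 0 ≤ t ∧ C.FaceOf (v - t • y) v ∧ (v - t • y ≠ 0 → ¬ C.FaceOf v (v - t • y)) := by
  let P : Set (Λ × ι) := {p | p.1 ∈ C.near v ∧ C.coord p.1 p.2 v ≠ 0}
  have hP : P.Finite :=
    (hfin.prod (Set.finite_univ : (Set.univ : Set ι).Finite)).subset fun p hp => ⟨hp.1, trivial⟩
  have hne : P.Nonempty := by
    obtain ⟨l, hl⟩ := hv.2
    by_contra hcon
    refine hv.1 (C.pointed l v fun k => ?_)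
    by_contra hk
    exact hcon ⟨(l, k), support_subset_near hv.1 hl, hk⟩
  have hpos : ∀ l ∈ C.near v, ∀ k, C.coord l k v ≠ 0 →
      0 < C.coord l k v / C.coord l k y := by
    intro l hl k hk
    obtain ⟨-, a1, a2⟩ := h l hl k
    have b0 := (h' l (h.near_subset hv.1 hl) k).1
    rcases hk.lt_or_gt with hlt | hlt
    · exact div_pos_of_neg_of_neg hlt (lt_of_le_of_ne (a2 hlt) fun h0 => hk (b0 h0))
    · exact div_pos hlt (lt_of_le_of_ne (a1 hlt) fun h0 => hk (b0 h0.symm))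
  -- The ratio is the time at which a coordinate of `v - t • y` reaches zero; the smallest ratio is
  -- the exit time from the closed cell.
  obtain ⟨p, hp, hmin⟩ := hP.exists_minimalFor
    (fun p : Λ × ι => C.coord p.1 p.2 v / C.coord p.1 p.2 y) P hne
  have hmin' : ∀ l ∈ C.near v, ∀ k, C.coord l k v ≠ 0 →
      C.coord p.1 p.2 v / C.coord p.1 p.2 y ≤ C.coord l k v / C.coord l k y := by
    intro l hl k hk
    rcases le_total (C.coord p.1 p.2 v / C.coord p.1 p.2 y)
      (C.coord l k v / C.coord l k y) with h1 | h1
    · exact h1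
    · exact hmin (j := (l, k)) ⟨hl, hk⟩ h1
  set t := C.coord p.1 p.2 v / C.coord p.1 p.2 y with ht
  have htpos : 0 < t := hpos _ hp.1 _ hp.2
  have hface : C.FaceOf (v - t • y) v := by
    intro l hl k
    obtain ⟨a0, a1, a2⟩ := h l hl k
    simp only [map_sub, map_smul, smul_eq_mul]
    refine ⟨fun hz => by rw [hz, a0 hz]; simp, fun hz => ?_, fun hz => ?_⟩
    · have h1 := hmin' l hl k hz.ne'
      have h2 : 0 < C.coord l k y := by
        have := hpos l hl k hz.ne'
        exact (div_pos_iff_of_pos_left hz).1 this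
      rw [le_div_iff₀ h2] at h1
      linarith
    · have h1 := hmin' l hl k hz.ne
      have h2 : C.coord l k y < 0 := by
        have h3 := hpos l hl k hz.ne
        by_contra! h4
        exact absurd (div_nonpos_of_nonpos_of_nonneg hz.le h4) (not_le.2 h3)
      rw [le_div_iff_of_neg h2] at h1
      linarith
  refine ⟨t, htpos.le, hface, fun _ hcon => ?_⟩
  have hy0 : C.coord p.1 p.2 y ≠ 0 := by
    intro h0
    rw [ht, h0, div_zero] at htpos
    exact htpos.false
  have h0 : C.coord p.1 p.2 (v - t • y) = 0 := by
    simp only [map_sub, map_smul, smul_eq_mul, ht]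
    field_simp
    ring
  exact hp.2 ((hcon p.1 (hface.near_subset hv.1 hp.1) p.2).1 h0)

variable [FiniteDimensional ℝ V]

theorem rank_le (v : V) : C.rank v ≤ Module.finrank ℝ V := Submodule.finrank_le _

theorem one_le_rank {v : V} (hv : v ≠ 0) : 1 ≤ C.rank v := by
  rw [rank, Nat.one_le_iff_ne_zero, Ne, Submodule.finrank_eq_zero]
  intro h
  exact hv (by simpa [h] using C.self_mem_cellSpan v)

theorem FaceOf.rank_le {w v : V} (h : C.FaceOf w v) (hv : v ≠ 0) : C.rank w ≤ C.rank v :=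
  Submodule.finrank_mono (h.cellSpan_le hv)

/-- With equal spans, `v` would lie in the span of the cell of `w`, so every coordinate vanishing at
`w` would vanish at `v`, and the face would not be proper. -/
theorem FaceOf.rank_lt {w v : V} (h : C.FaceOf w v) (hv : C.Covered v) (hw : w ≠ 0)
    (h' : ¬ C.FaceOf v w) : C.rank w < C.rank v := by
  refine Submodule.finrank_lt_finrank_of_lt (lt_of_le_of_ne (h.cellSpan_le hv.1) ?_)
  intro heq
  refine h' (h.antisymm_of_zero hv hw fun l hl k hz => ?_)
  have := C.self_mem_cellSpan v
  rw [← heq] at this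
  exact this l (h.near_subset hv.1 hl) k hz

/-- A choice of one point in each cell of a locally finite family of cones. -/
structure IsCentered (C : ConeFamily V Λ ι) (Y : Set V) : Prop where
  covered : ∀ y ∈ Y, C.Covered y
  exists_center : ∀ v, C.Covered v → ∃ y ∈ Y, C.FaceOf y v ∧ C.FaceOf v y
  eq_of_faceOf : ∀ y ∈ Y, ∀ z ∈ Y, C.FaceOf y z → C.FaceOf z y → y = z
  finite_near : ∀ v, C.Covered v → (C.near v).Finite
  locallyFinite : ∀ v, C.Covered v →
    ∃ U ∈ 𝓝 v, (∀ u ∈ U, C.Covered u) ∧ (⋃ u ∈ U, C.support u).Finite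
  finite_centers : ∀ l, {y ∈ Y | l ∈ C.support y}.Finite

end ConeFamily
end Hyperbolic
end

/-! ### Flags of cells and uniqueness of barycentric coordinates. -/

noncomputable section
namespace Hyperbolic
open Topology
namespace ConeFamily

variable {V Λ ι : Type*} [NormedAddCommGroup V] [NormedSpace ℝ V] {C : ConeFamily V Λ ι} {Y : Set V}

variable (C Y) in
/-- A full flag of cells, recorded by the centres of its cells. -/
@[ext] structure Flag (n : ℕ) where
  vertex : Fin (n + 1) → V
  mem : ∀ k, vertex k ∈ Y
  faceOf : ∀ k l, k ≤ l → C.FaceOf (vertex k) (vertex l)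
  rank : ∀ k, C.rank (vertex k) = k + 1

namespace Flag

variable {n : ℕ}

/-- The combination of the vertices of a flag with coefficients `t`. -/
def comb (F : C.Flag Y n) (t : Fin (n + 1) → ℝ) : V := ∑ k, t k • F.vertex k

theorem comb_add (F : C.Flag Y n) (s t : Fin (n + 1) → ℝ) :
    F.comb (s + t) = F.comb s + F.comb t := by
  simp only [comb, Pi.add_apply, add_smul, Finset.sum_add_distrib]

theorem comb_sub (F : C.Flag Y n) (s t : Fin (n + 1) → ℝ) :
    F.comb (s - t) = F.comb s - F.comb t := by
  simp only [comb, Pi.sub_apply, sub_smul, Finset.sum_sub_distrib]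

theorem comb_smul (F : C.Flag Y n) (c : ℝ) (t : Fin (n + 1) → ℝ) :
    F.comb (c • t) = c • F.comb t := by
  simp only [comb, Pi.smul_apply, smul_eq_mul, mul_smul, Finset.smul_sum]

theorem comb_single (F : C.Flag Y n) (k : Fin (n + 1)) (a : ℝ) :
    F.comb (Pi.single k a) = a • F.vertex k := by
  classical
  rw [comb, Finset.sum_eq_single k]
  · simp
  · intro l _ h; simp [h]
  · simp

theorem comb_congr {F G : C.Flag Y n} {t : Fin (n + 1) → ℝ}
    (h : ∀ k, t k ≠ 0 → F.vertex k = G.vertex k) : F.comb t = G.comb t := by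
  refine Finset.sum_congr rfl fun k _ => ?_
  by_cases hk : t k = 0
  · simp [hk]
  · rw [h k hk]

/-- A nonnegative combination lies in the cell of its last vertex. -/
theorem comb_equiv (hY : C.IsCentered Y) (F : C.Flag Y n) {t : Fin (n + 1) → ℝ} (ht : ∀ k, 0 ≤ t k)
    {m : Fin (n + 1)} (hm : 0 < t m) (h0 : ∀ k, m < k → t k = 0) :
    C.FaceOf (F.comb t) (F.vertex m) ∧ C.FaceOf (F.vertex m) (F.comb t) ∧ F.comb t ≠ 0 := by
  classical
  have hc := hY.covered _ (F.mem m)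
  have : F.comb t = t m • F.vertex m + ∑ k ∈ Finset.univ.erase m, t k • F.vertex k := by
    rw [comb, Finset.add_sum_erase _ (fun k => t k • F.vertex k) (Finset.mem_univ m)]
  rw [this]
  refine FaceOf.smul_add (FaceOf.sum fun k _ => ?_) hc hm
  rcases le_or_gt k m with h | h
  · exact (F.faceOf k m h).smul (ht k)
  · rw [h0 k h, zero_smul]; exact FaceOf.zero _

theorem rank_comb (hY : C.IsCentered Y) (F : C.Flag Y n) {t : Fin (n + 1) → ℝ} (ht : ∀ k, 0 ≤ t k)
    {m : Fin (n + 1)} (hm : 0 < t m) (h0 : ∀ k, m < k → t k = 0) :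
    C.rank (F.comb t) = m + 1 := by
  obtain ⟨h1, h2, h3⟩ := F.comb_equiv hY ht hm h0
  rw [rank_eq h1 h2 (hY.covered _ (F.mem m)).1 h3, F.rank]

theorem exists_last (t : Fin (n + 1) → ℝ) (ht : ∀ k, 0 ≤ t k) (h : ∃ k, t k ≠ 0) :
    ∃ m, 0 < t m ∧ ∀ k, m < k → t k = 0 := by
  classical
  obtain ⟨k0, hk0⟩ := h
  have hne : (Finset.univ.filter fun k => t k ≠ 0).Nonempty := ⟨k0, by simp [hk0]⟩
  refine ⟨_, lt_of_le_of_ne (ht _) (Finset.mem_filter.1 (Finset.max'_mem _ hne)).2.symm,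
    fun k hk => ?_⟩
  by_contra hcon
  exact absurd (Finset.le_max' _ k (by simp [hcon])) (not_le.2 hk)

/-- The index of the last nonzero coefficient is intrinsic to the point: it is one less than the
rank of the point's cell. -/
theorem ne_zero_of_comb_eq (hY : C.IsCentered Y) (F G : C.Flag Y n) {s t : Fin (n + 1) → ℝ}
    (hs : ∀ k, 0 ≤ s k) (ht : ∀ k, 0 ≤ t k) (h : F.comb t = G.comb s) {m : Fin (n + 1)}
    (hm : 0 < t m) (h0 : ∀ k, m < k → t k = 0) : s m ≠ 0 := by
  intro hsm
  have hr := F.rank_comb hY ht hm h0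
  have hne := (F.comb_equiv hY ht hm h0).2.2
  by_cases hz : ∃ k, s k ≠ 0
  · obtain ⟨l, hl, hl0⟩ := exists_last s hs hz
    have hr' := G.rank_comb hY hs hl hl0
    rw [h, hr'] at hr
    have : l = m := Fin.ext (by omega)
    rw [this] at hl
    exact hl.ne' hsm
  · push Not at hz
    rw [h, comb] at hne
    exact hne (Finset.sum_eq_zero fun k _ => by rw [hz k, zero_smul])

/-- Nonnegative combinations of the vertices of flags are unique. -/
theorem comb_unique (hY : C.IsCentered Y) (F G : C.Flag Y n) {t s : Fin (n + 1) → ℝ}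
    (ht : ∀ k, 0 ≤ t k) (hs : ∀ k, 0 ≤ s k) (h : F.comb t = G.comb s) :
    t = s ∧ ∀ k, t k ≠ 0 → F.vertex k = G.vertex k := by
  classical
  -- Induction on a strict upper bound `m` for the indices of nonzero coefficients.
  suffices H : ∀ m : ℕ, ∀ t s : Fin (n + 1) → ℝ, (∀ k, 0 ≤ t k) → (∀ k, 0 ≤ s k) →
      (∀ k : Fin (n + 1), m ≤ k → t k = 0) → (∀ k : Fin (n + 1), m ≤ k → s k = 0) →
      F.comb t = G.comb s → t = s ∧ ∀ k, t k ≠ 0 → F.vertex k = G.vertex k from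
    H (n + 1) t s ht hs (fun k hk => absurd k.2 (by omega)) (fun k hk => absurd k.2 (by omega)) h
  intro m
  induction m with
  | zero =>
    intro t s _ _ ht0 hs0 _
    refine ⟨funext fun k => by rw [ht0 k (Nat.zero_le _), hs0 k (Nat.zero_le _)], fun k hk => ?_⟩
    exact absurd (ht0 k (Nat.zero_le _)) hk
  | succ m ih =>
    intro t s ht hs ht0 hs0 h
    by_cases hmn : m < n + 1
    swap
    · exact ih t s ht hs (fun k hk => absurd k.2 (by omega)) (fun k hk => absurd k.2 (by omega)) h
    let K : Fin (n + 1) := ⟨m, hmn⟩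
    have hup : ∀ u : Fin (n + 1) → ℝ, (∀ k : Fin (n + 1), m + 1 ≤ k → u k = 0) →
        ∀ k, K < k → u k = 0 := fun u hu k hk => hu k hk
    have hdown : ∀ u : Fin (n + 1) → ℝ, (∀ k : Fin (n + 1), m + 1 ≤ k → u k = 0) → u K = 0 →
        ∀ k : Fin (n + 1), m ≤ k → u k = 0 := by
      intro u hu hK k hk
      rcases hk.eq_or_lt with h' | h'
      · have : k = K := Fin.ext h'.symm
        rw [this, hK]
      · exact hu k h'
    by_cases htK : t K = 0
    · have hsK : s K = 0 := by
        by_contra hsK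
        exact ne_zero_of_comb_eq hY G F ht hs h.symm (lt_of_le_of_ne (hs K) (Ne.symm hsK))
          (hup s hs0) htK
      exact ih t s ht hs (hdown t ht0 htK) (hdown s hs0 hsK) h
    have htK' : 0 < t K := lt_of_le_of_ne (ht K) (Ne.symm htK)
    have hsK : s K ≠ 0 := ne_zero_of_comb_eq hY F G hs ht h htK' (hup t ht0)
    have hsK' : 0 < s K := lt_of_le_of_ne (hs K) (Ne.symm hsK)
    -- Both vertices are centres of the cell that contains the common point.
    have hFG : F.vertex K = G.vertex K := by
      obtain ⟨a1, a2, a3⟩ := F.comb_equiv hY ht htK' (hup t ht0)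
      obtain ⟨b1, b2, b3⟩ := G.comb_equiv hY hs hsK' (hup s hs0)
      rw [h] at a1 a2
      exact hY.eq_of_faceOf _ (F.mem K) _ (G.mem K)
        (a2.trans b1 (hY.covered _ (G.mem K)).1) (b2.trans a1 (hY.covered _ (F.mem K)).1)
    -- Subtracting the smaller top coefficient on both sides kills one of the two; the other then
    -- vanishes as well, since the last nonzero index is intrinsic.
    let r := min (t K) (s K)
    have hsub : ∀ u : Fin (n + 1) → ℝ, (∀ k, 0 ≤ u k) → r ≤ u K →
        ∀ k, 0 ≤ (u - Pi.single K r : Fin (n + 1) → ℝ) k := by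
      intro u hu hr k
      by_cases hk : k = K
      · subst hk; simpa using hr
      · simpa [hk] using hu k
    have hsub0 : ∀ u : Fin (n + 1) → ℝ, (∀ k : Fin (n + 1), m + 1 ≤ k → u k = 0) →
        ∀ k : Fin (n + 1), m + 1 ≤ k → (u - Pi.single K r : Fin (n + 1) → ℝ) k = 0 := by
      intro u hu k hk
      have : k ≠ K := by rintro rfl; simp [K] at hk
      simp [this, hu k hk]
    have h' : F.comb (t - Pi.single K r) = G.comb (s - Pi.single K r) := by
      rw [comb_sub, comb_sub, comb_single, comb_single, h, hFG]
    have ht1 := hsub t ht (min_le_left _ _)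
    have hs1 := hsub s hs (min_le_right _ _)
    have hzero : (t - Pi.single K r : Fin (n + 1) → ℝ) K = 0 ∧
        (s - Pi.single K r : Fin (n + 1) → ℝ) K = 0 := by
      rcases le_total (t K) (s K) with hle | hle
      · have hz : (t - Pi.single K r : Fin (n + 1) → ℝ) K = 0 := by simp [r, hle]
        refine ⟨hz, ?_⟩
        by_contra hcon
        exact ne_zero_of_comb_eq hY G F ht1 hs1 h'.symm (lt_of_le_of_ne (hs1 K) (Ne.symm hcon))
          (hup _ (hsub0 s hs0)) hz
      · have hz : (s - Pi.single K r : Fin (n + 1) → ℝ) K = 0 := by simp [r, hle]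
        refine ⟨?_, hz⟩
        by_contra hcon
        exact ne_zero_of_comb_eq hY F G hs1 ht1 h' (lt_of_le_of_ne (ht1 K) (Ne.symm hcon))
          (hup _ (hsub0 t ht0)) hz
    obtain ⟨e1, e2⟩ := ih _ _ ht1 hs1 (hdown _ (hsub0 t ht0) hzero.1)
      (hdown _ (hsub0 s hs0) hzero.2) h'
    have hts : t = s := by simpa using e1
    refine ⟨hts, fun k hk => ?_⟩
    by_cases hkK : k = K
    · rw [hkK, hFG]
    · exact e2 k (by simpa [hkK] using hk)

/-- Separating the positive and negative parts of a linear relation gives two nonnegative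
combinations of the same point, which must have equal coefficients. -/
theorem linearIndependent (hY : C.IsCentered Y) (F : C.Flag Y n) :
    LinearIndependent ℝ F.vertex := by
  rw [Fintype.linearIndependent_iff]
  intro g hg k
  have h : F.comb (fun k => max (g k) 0) = F.comb (fun k => max (-g k) 0) := by
    rw [← sub_eq_zero, ← comb_sub]
    refine Eq.trans (Finset.sum_congr rfl fun k _ => ?_) hg
    simp only [Pi.sub_apply]
    rcases le_total (g k) 0 with h | h <;> simp [h]
  have := congrFun (comb_unique hY F F (fun _ => le_max_right _ _) (fun _ => le_max_right _ _)
    h).1 k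
  rcases le_total (g k) 0 with h | h
  · rw [max_eq_right h, max_eq_left (neg_nonneg.2 h)] at this; linarith
  · rw [max_eq_left h, max_eq_right (neg_nonpos.2 h)] at this; linarith

end Flag

/-- Every covered point is a nonnegative combination of a chain of centres. -/
theorem IsCentered.exists_chain [FiniteDimensional ℝ V] [Finite ι] (hY : C.IsCentered Y) (v : V) (hv : C.Covered v) :
    ∃ s : Finset V, ↑s ⊆ Y ∧ (∀ y ∈ s, C.FaceOf y v) ∧
      (∀ y ∈ s, ∀ z ∈ s, y = z ∨ (C.FaceOf y z ∧ C.rank y < C.rank z) ∨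
        (C.FaceOf z y ∧ C.rank z < C.rank y)) ∧
      ∃ c : V → ℝ, (∀ y, 0 ≤ c y) ∧ v = ∑ y ∈ s, c y • y := by
  classical
  induction hr : C.rank v using Nat.strong_induction_on generalizing v with
  | _ r ih =>
    obtain ⟨y, hyY, hyv, hvy⟩ := hY.exists_center v hv
    have hy0 := (hY.covered y hyY).1
    -- Radial projection from the centre, as in barycentric subdivision: what is left after removing
    -- `t • y` is zero or lies in a proper face, where the rank is smaller.
    obtain ⟨t, ht, hface, hnot⟩ := exists_sub_smul hv (hY.finite_near v hv) hyv hvy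
    by_cases hw : v - t • y = 0
    · refine ⟨{y}, by simpa using hyY, by simpa using hyv, by simp, fun _ => t, fun _ => ht, ?_⟩
      simpa using sub_eq_zero.1 hw
    · have hlt := hface.rank_lt hv hw (hnot hw)
      obtain ⟨s, hsY, hsv, hs, c, hc, hsum⟩ :=
        ih _ (hr ▸ hlt) (v - t • y) (hface.covered hv hw) rfl
      have hry : C.rank y = C.rank v := rank_eq hyv hvy hv.1 hy0
      have hzy : ∀ z ∈ s, C.FaceOf z y ∧ C.rank z < C.rank y := by
        intro z hz
        refine ⟨((hsv z hz).trans hface hv.1).trans hvy hy0, ?_⟩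
        rw [hry]
        exact ((hsv z hz).rank_le hw).trans_lt hlt
      have hys : y ∉ s := fun h => (hzy y h).2.false
      refine ⟨insert y s, ?_, ?_, ?_, Function.update c y t, ?_, ?_⟩
      · rw [Finset.coe_insert]; exact Set.insert_subset hyY hsY
      · intro z hz
        rcases Finset.mem_insert.1 hz with rfl | hz
        · exact hyv
        · exact (hsv z hz).trans hface hv.1
      · intro z hz z' hz'
        rcases Finset.mem_insert.1 hz with rfl | hz <;> rcases Finset.mem_insert.1 hz' with rfl | hz'
        · exact Or.inl rfl
        · exact Or.inr (Or.inr (hzy _ hz'))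
        · exact Or.inr (Or.inl (hzy _ ‹_›))
        · exact hs z hz z' hz'
      · intro z
        by_cases h : z = y
        · subst h; simpa using ht
        · simpa [h] using hc z
      · rw [Finset.sum_insert hys, Function.update_self]
        have : ∑ z ∈ s, Function.update c y t z • z = ∑ z ∈ s, c z • z :=
          Finset.sum_congr rfl fun z hz => by
            rw [Function.update_of_ne (by rintro rfl; exact hys hz)]
        rw [this, ← hsum]; abel

end ConeFamily
end Hyperbolic
end

/-! ### The flag cones are closed, locally finite and covering. -/

noncomputable section
namespace Hyperbolic
open Topology

/-- Baire category: a proper subspace is closed with empty interior. It supplies the points in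
general position below. -/
theorem exists_mem_open_forall_notMem {V : Type*} [NormedAddCommGroup V] [NormedSpace ℝ V]
    [FiniteDimensional ℝ V] {O : Set V} (hO : IsOpen O) (hne : O.Nonempty)
    {S : Set (Submodule ℝ V)} (hS : S.Finite) (htop : ∀ W ∈ S, W ≠ ⊤) :
    ∃ x ∈ O, ∀ W ∈ S, x ∉ W := by
  have := FiniteDimensional.proper ℝ V
  have hd : Dense (⋂ W ∈ S, (W : Set V)ᶜ) := by
    refine dense_biInter_of_isOpen (fun W _ => ?_) hS.countable (fun W hW => ?_)
    · exact (Submodule.closed_of_finiteDimensional W).isOpen_compl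
    · rw [← interior_eq_empty_iff_dense_compl]
      by_contra hcon
      exact htop W hW (Submodule.eq_top_of_nonempty_interior' W
        (Set.nonempty_iff_ne_empty.2 hcon))
  obtain ⟨x, hxO, hx⟩ := hd.inter_open_nonempty O hO hne
  refine ⟨x, hxO, fun W hW => ?_⟩
  simp only [Set.mem_iInter] at hx
  exact hx W hW

namespace ConeFamily

variable {V Λ ι : Type*} [NormedAddCommGroup V] [NormedSpace ℝ V] {C : ConeFamily V Λ ι}
  {Y : Set V} {n : ℕ}

namespace Flag

/-- The closed simplicial cone spanned by the vertices of a flag. -/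
def cone (F : C.Flag Y n) : Set V := {v | ∃ t, (∀ k, 0 ≤ t k) ∧ v = F.comb t}

theorem mem_support_comb (F : C.Flag Y n) {t : Fin (n + 1) → ℝ} (ht : ∀ k, 0 ≤ t k) {l : Λ}
    (hl : ∀ k, l ∈ C.support (F.vertex k)) : l ∈ C.support (F.comb t) := by
  intro k
  rw [comb, map_sum]
  refine Finset.sum_nonneg fun m _ => ?_
  rw [map_smul]
  exact mul_nonneg (ht m) (hl m k)

theorem mem_support_vertex (hY : C.IsCentered Y) (F : C.Flag Y n) {l : Λ}
    (hl : l ∈ C.support (F.vertex (Fin.last n))) (k : Fin (n + 1)) :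
    l ∈ C.support (F.vertex k) :=
  (F.faceOf k _ (Fin.le_last k)).support_subset (hY.covered _ (F.mem _)).1 hl

/-- A cone that contains the last vertex contains all vertices, since these lie in the faces of the
last cell; each cone has only finitely many centres. -/
theorem finite_setOf_mem_support (hY : C.IsCentered Y) (l : Λ) :
    {F : C.Flag Y n | l ∈ C.support (F.vertex (Fin.last n))}.Finite := by
  refine Set.Finite.of_finite_image (f := vertex)
    ((Set.Finite.pi' fun _ => hY.finite_centers l).subset ?_) fun F _ G _ h => Flag.ext h
  rintro _ ⟨F, hF, rfl⟩ k
  exact ⟨F.mem k, F.mem_support_vertex hY hF k⟩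

theorem covered_of_mem_cone (hY : C.IsCentered Y) (F : C.Flag Y n) {v : V} (hv : v ∈ F.cone)
    (h0 : v ≠ 0) : C.Covered v := by
  obtain ⟨t, ht, rfl⟩ := hv
  obtain ⟨l, hl⟩ := (hY.covered _ (F.mem (Fin.last n))).2
  exact ⟨h0, l, F.mem_support_comb ht (F.mem_support_vertex hY hl)⟩

theorem exists_finite_nhds (hY : C.IsCentered Y) {p : V} (hp : C.Covered p) :
    ∃ U ∈ 𝓝 p, (∀ u ∈ U, C.Covered u) ∧ {F : C.Flag Y n | (F.cone ∩ U).Nonempty}.Finite ∧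
      {y ∈ Y | ∃ u ∈ U, (C.support u ∩ C.support y).Nonempty}.Finite := by
  obtain ⟨U, hU, hcov, hfin⟩ := hY.locallyFinite p hp
  refine ⟨U, hU, hcov, ?_, ?_⟩
  · refine (hfin.biUnion fun l _ => finite_setOf_mem_support hY l).subset ?_
    rintro F ⟨v, ⟨t, ht, rfl⟩, hv⟩
    obtain ⟨l, hl⟩ := (hY.covered _ (F.mem (Fin.last n))).2
    simp only [Set.mem_iUnion]
    exact ⟨l, ⟨_, hv, F.mem_support_comb ht (F.mem_support_vertex hY hl)⟩, hl⟩
  · refine (hfin.biUnion fun l _ => hY.finite_centers l).subset ?_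
    rintro y ⟨hy, u, hu, l, hlu, hly⟩
    simp only [Set.mem_iUnion]
    exact ⟨l, ⟨u, hu, hlu⟩, hy, hly⟩

/-- The vertices of a flag as a basis. -/
def basis (hY : C.IsCentered Y) (hn : Module.finrank ℝ V = n + 1) (F : C.Flag Y n) :
    Module.Basis (Fin (n + 1)) ℝ V :=
  basisOfLinearIndependentOfCardEqFinrank (F.linearIndependent hY) (by simp [hn])

variable (hY : C.IsCentered Y) (hn : Module.finrank ℝ V = n + 1)

theorem basis_apply (F : C.Flag Y n) (k : Fin (n + 1)) : F.basis hY hn k = F.vertex k := by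
  simp [basis]

theorem comb_repr (F : C.Flag Y n) (v : V) : F.comb ((F.basis hY hn).repr v) = v := by
  conv_rhs => rw [← (F.basis hY hn).sum_repr v]
  simp only [basis_apply]; rfl

theorem repr_comb (F : C.Flag Y n) (t : Fin (n + 1) → ℝ) (k : Fin (n + 1)) :
    (F.basis hY hn).repr (F.comb t) k = t k := by
  have : F.comb t = ∑ k, t k • F.basis hY hn k := by simp only [basis_apply]; rfl
  rw [this, (F.basis hY hn).repr_sum_self]

theorem mem_cone_iff (F : C.Flag Y n) (v : V) :
    v ∈ F.cone ↔ ∀ k, 0 ≤ (F.basis hY hn).repr v k := by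
  constructor
  · rintro ⟨t, ht, rfl⟩ k
    rw [repr_comb]; exact ht k
  · exact fun h => ⟨_, h, (F.comb_repr hY hn v).symm⟩

variable [FiniteDimensional ℝ V]

theorem continuous_repr (F : C.Flag Y n) (k : Fin (n + 1)) :
    Continuous fun v => (F.basis hY hn).repr v k :=
  LinearMap.continuous_of_finiteDimensional ((F.basis hY hn).coord k)

include hY hn in
theorem isClosed_cone (F : C.Flag Y n) : IsClosed F.cone := by
  have : F.cone = ⋂ k, {v | 0 ≤ (F.basis hY hn).repr v k} := by
    ext v; simp [F.mem_cone_iff hY hn]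
  rw [this]
  exact isClosed_iInter fun k => isClosed_le continuous_const (F.continuous_repr hY hn k)

end Flag

variable [FiniteDimensional ℝ V] (hY : C.IsCentered Y) (hn : Module.finrank ℝ V = n + 1)

include hY hn in
/-- A spanning chain of centres is a full flag. -/
theorem exists_flag_of_span_eq_top {s : Finset V} (hsY : ↑s ⊆ Y)
    (hs : ∀ y ∈ s, ∀ z ∈ s, y = z ∨ (C.FaceOf y z ∧ C.rank y < C.rank z) ∨
        (C.FaceOf z y ∧ C.rank z < C.rank y))
    (hspan : Submodule.span ℝ (s : Set V) = ⊤) :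
    ∃ F : C.Flag Y n, Set.BijOn F.vertex Set.univ s := by
  classical
  have hinj : Set.InjOn C.rank (s : Set V) := by
    intro y hy z hz h
    rcases hs y hy z hz with h' | h' | h'
    · exact h'
    · exact absurd h h'.2.ne
    · exact absurd h h'.2.ne'
  have hcard : n + 1 ≤ s.card := by
    have := finrank_span_finset_le_card (R := ℝ) s
    rwa [Set.finrank, hspan, finrank_top, hn] at this
  have himg : s.image C.rank = Finset.Icc 1 (n + 1) := by
    refine Finset.eq_of_subset_of_card_le ?_ ?_
    · intro r hr
      obtain ⟨y, hy, rfl⟩ := Finset.mem_image.1 hr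
      exact Finset.mem_Icc.2 ⟨one_le_rank (hY.covered y (hsY hy)).1, hn ▸ rank_le y⟩
    · rw [Finset.card_image_of_injOn hinj]; simpa using hcard
  have hex : ∀ k : Fin (n + 1), ∃ y ∈ s, C.rank y = k + 1 := by
    intro k
    have : (k : ℕ) + 1 ∈ s.image C.rank := by
      rw [himg]; exact Finset.mem_Icc.2 ⟨by omega, by omega⟩
    simpa using this
  choose f hfs hfr using hex
  refine ⟨⟨f, fun k => hsY (hfs k), fun k l hkl => ?_, hfr⟩, fun k _ => hfs k, ?_, ?_⟩
  · rcases hs _ (hfs k) _ (hfs l) with h | h | h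
    · rw [h]; exact FaceOf.refl _
    · exact h.1
    · have := h.2
      rw [hfr, hfr] at this
      exact absurd (Fin.le_def.1 hkl) (by omega)
  · intro k _ l _ h
    have : C.rank (f k) = C.rank (f l) := congrArg C.rank h
    rw [hfr, hfr] at this
    exact Fin.ext (by omega)
  · intro y hy
    have hy1 : C.rank y ∈ Finset.Icc 1 (n + 1) := himg ▸ Finset.mem_image_of_mem _ hy
    rw [Finset.mem_Icc] at hy1
    refine ⟨⟨C.rank y - 1, by omega⟩, trivial, hinj (hfs _) hy ?_⟩
    rw [hfr]; simp only; omega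

include hY hn in
/-- The cones of the full flags cover. -/
theorem exists_mem_cone [Finite ι] {v : V} (hv : C.Covered v) :
    ∃ F : C.Flag Y n, v ∈ F.cone := by
  classical
  by_contra! hcon
  obtain ⟨U, hU, hcov, hflag, hcent⟩ := Flag.exists_finite_nhds (n := n) hY hv
  set Z := {y ∈ Y | ∃ u ∈ U, (C.support u ∩ C.support y).Nonempty} with hZ
  let 𝓕 := {F : C.Flag Y n | (F.cone ∩ U).Nonempty}
  have hclosed : IsClosed (⋃ F ∈ 𝓕, F.cone) :=
    hflag.isClosed_biUnion fun F _ => F.isClosed_cone hY hn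
  let S : Set (Submodule ℝ V) := {W | W ≠ ⊤ ∧ ∃ s ∈ Z.powerset, W = Submodule.span ℝ s}
  have hS : S.Finite := by
    refine (hcent.finite_subsets.image (Submodule.span ℝ)).subset ?_
    rintro W ⟨-, s, hs, rfl⟩
    exact ⟨s, hs, rfl⟩
  -- If `v` is missed, so is an open set near `v`. A point `u` there can avoid every proper subspace
  -- spanned by nearby centres; the chain of centres that expresses `u` must then span, hence is a
  -- full flag whose cone contains `u`.
  obtain ⟨u, hu, huS⟩ := exists_mem_open_forall_notMem
    (isOpen_interior.sdiff hclosed : IsOpen (interior U \ ⋃ F ∈ 𝓕, F.cone))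
    ⟨v, mem_interior_iff_mem_nhds.2 hU, by simpa using fun F _ => hcon F⟩ hS fun W hW => hW.1
  have huU := interior_subset hu.1
  obtain ⟨s, hsY, hsu, hs, c, hc, hsum⟩ := hY.exists_chain u (hcov u huU)
  have hsZ : (s : Set V) ⊆ Z := by
    intro y hy
    obtain ⟨l, hl⟩ := (hcov u huU).2
    exact ⟨hsY hy, u, huU, l, hl, (hsu y hy).support_subset (hcov u huU).1 hl⟩
  have hspan : Submodule.span ℝ (s : Set V) = ⊤ := by
    by_contra hne
    refine huS _ ⟨hne, s, hsZ, rfl⟩ ?_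
    rw [hsum]
    exact Submodule.sum_mem _ fun y hy => Submodule.smul_mem _ _ (Submodule.subset_span hy)
  obtain ⟨F, hF⟩ := exists_flag_of_span_eq_top hY hn hsY hs hspan
  have huF : u ∈ F.cone := by
    refine ⟨fun k => c (F.vertex k), fun k => hc _, ?_⟩
    rw [hsum, Flag.comb]
    symm
    exact Finset.sum_nbij F.vertex (fun k _ => hF.mapsTo trivial)
      (fun k _ l _ h => hF.injOn trivial trivial h)
      (by simpa using hF.surjOn) (fun _ _ => rfl)
  refine hu.2 (Set.mem_biUnion (?_ : F ∈ 𝓕) huF)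
  exact ⟨u, huF, huU⟩

include hY hn in
/-- Near a covered point there are only finitely many flags, and all of them contain it. -/
theorem exists_ball {p : V} (hp : C.Covered p) :
    ∃ ε > 0, (∀ u ∈ Metric.ball p ε, C.Covered u) ∧
      {F : C.Flag Y n | (F.cone ∩ Metric.ball p ε).Nonempty}.Finite ∧
      ∀ F : C.Flag Y n, ∀ u ∈ Metric.ball p ε, u ∈ F.cone → p ∈ F.cone := by
  obtain ⟨U, hU, hcov, hflag, -⟩ := Flag.exists_finite_nhds (n := n) hY hp
  let 𝓕 := {F : C.Flag Y n | (F.cone ∩ U).Nonempty ∧ p ∉ F.cone}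
  have h𝓕 : 𝓕.Finite := hflag.subset fun F hF => hF.1
  have hclosed : IsClosed (⋃ F ∈ 𝓕, F.cone) :=
    h𝓕.isClosed_biUnion fun F _ => F.isClosed_cone hY hn
  -- The cones that meet `U` but miss `p` are finitely many closed sets, and can be removed.
  have hmem : U ∩ (⋃ F ∈ 𝓕, F.cone)ᶜ ∈ 𝓝 p := by
    refine Filter.inter_mem hU (hclosed.isOpen_compl.mem_nhds ?_)
    simp only [Set.mem_compl_iff, Set.mem_iUnion, not_exists]
    exact fun F hF => hF.2
  obtain ⟨ε, hε, hball⟩ := Metric.mem_nhds_iff.1 hmem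
  refine ⟨ε, hε, fun u hu => hcov u (hball hu).1, hflag.subset ?_, fun F u hu huF => ?_⟩
  · rintro F ⟨u, huF, hu⟩
    exact ⟨u, huF, (hball hu).1⟩
  · by_contra hcon
    exact (hball hu).2 (Set.mem_biUnion (show F ∈ 𝓕 from ⟨⟨u, huF, (hball hu).1⟩, hcon⟩) huF)

end ConeFamily
end Hyperbolic
end

/-! ### Adjacent flags and connectedness of stars. -/

noncomputable section
namespace Hyperbolic
open Topology
namespace ConeFamily

variable {V Λ ι : Type*} [NormedAddCommGroup V] [NormedSpace ℝ V] {C : ConeFamily V Λ ι}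
  {Y : Set V} {n : ℕ}

namespace Flag

/-- `F` and `G` have the same vertices, except possibly for the vertex `k`. -/
def AgreeOff (k : Fin (n + 1)) (F G : C.Flag Y n) : Prop :=
  ∀ l, l ≠ k → F.vertex l = G.vertex l

theorem AgreeOff.symm {k : Fin (n + 1)} {F G : C.Flag Y n} (h : AgreeOff k F G) :
    AgreeOff k G F := fun l hl => (h l hl).symm

theorem AgreeOff.trans {k : Fin (n + 1)} {F G H : C.Flag Y n} (h : AgreeOff k F G)
    (h' : AgreeOff k G H) : AgreeOff k F H := fun l hl => (h l hl).trans (h' l hl)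

theorem AgreeOff.comb_eq {k : Fin (n + 1)} {F G : C.Flag Y n} (h : AgreeOff k F G)
    {t : Fin (n + 1) → ℝ} (ht : t k = 0) : F.comb t = G.comb t :=
  comb_congr fun l hl => h l (by rintro rfl; exact hl ht)

theorem AgreeOff.eq_of_vertex {k : Fin (n + 1)} {F G : C.Flag Y n} (h : AgreeOff k F G)
    (hk : F.vertex k = G.vertex k) : F = G := by
  refine Flag.ext (funext fun l => ?_)
  by_cases hl : l = k
  · rw [hl, hk]
  · exact h l hl

variable (hY : C.IsCentered Y) (hn : Module.finrank ℝ V = n + 1)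

/-- Two flags on the same side of a common facet coincide: adding a large combination of the shared
vertices to the `k`-th vertex of `G` gives a point of both cones whose coefficient at `k` is
positive, so uniqueness identifies the `k`-th vertices. -/
theorem AgreeOff.eq_of_pos {k : Fin (n + 1)} {F G : C.Flag Y n} (h : AgreeOff k F G)
    (hpos : 0 < (F.basis hY hn).repr (G.vertex k) k) : F = G := by
  classical
  set a : Fin (n + 1) → ℝ := ⇑((F.basis hY hn).repr (G.vertex k)) with ha
  let u : Fin (n + 1) → ℝ := fun l => if l = k then 0 else |a l|
  have hu : ∀ l, 0 ≤ u l := by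
    intro l; simp only [u]; split_ifs
    · exact le_rfl
    · exact abs_nonneg _
  have heq : F.comb (a + u) = G.comb (Pi.single k 1 + u) := by
    rw [comb_add, comb_add, comb_single, one_smul, ha, comb_repr, h.comb_eq (by simp [u])]
  have := (comb_unique hY F G (fun l => ?_) (fun l => ?_) heq).2 k (by simp [u, hpos.ne'])
  · exact h.eq_of_vertex this
  · by_cases hl : l = k
    · subst hl; simpa [u] using hpos.le
    · simp only [Pi.add_apply, u, hl, if_false]
      linarith [neg_abs_le (a l)]
  · refine add_nonneg ?_ (hu l)
    by_cases hl : l = k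
    · subst hl; simp
    · simp [hl]

theorem AgreeOff.repr_ne_zero {k : Fin (n + 1)} {F G : C.Flag Y n} (h : AgreeOff k F G) :
    (F.basis hY hn).repr (G.vertex k) k ≠ 0 := by
  intro h0
  have h1 : G.vertex k = G.comb ((F.basis hY hn).repr (G.vertex k)) := by
    rw [← h.comb_eq h0, comb_repr]
  have h2 := congrArg (fun v => (G.basis hY hn).repr v k) h1
  simp only [repr_comb, h0] at h2
  rw [← G.basis_apply hY hn, (G.basis hY hn).repr_self] at h2
  simp at h2

-- If both differ from `F`, the `k`-th vertices of `G` and `H` lie strictly on the other side of the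
-- facet from `F`, hence on the same side as each other.
include hY hn in
theorem mate_unique {k : Fin (n + 1)} {F G H : C.Flag Y n} (hG : AgreeOff k F G)
    (hH : AgreeOff k F H) (hFG : F ≠ G) (hFH : F ≠ H) : G = H := by
  classical
  have hGH := hG.symm.trans hH
  have ha : (F.basis hY hn).repr (G.vertex k) k < 0 :=
    lt_of_le_of_ne (not_lt.1 fun h => hFG (hG.eq_of_pos hY hn h)) (hG.repr_ne_zero hY hn)
  have hb : (F.basis hY hn).repr (H.vertex k) k < 0 :=
    lt_of_le_of_ne (not_lt.1 fun h => hFH (hH.eq_of_pos hY hn h)) (hH.repr_ne_zero hY hn)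
  refine hGH.eq_of_pos hY hn ?_
  set d : Fin (n + 1) → ℝ := ⇑((G.basis hY hn).repr (H.vertex k)) with hd
  let e : Fin (n + 1) → ℝ := fun l => if l = k then 0 else d l
  have hde : d = Pi.single k (d k) + e := by
    funext l
    by_cases hl : l = k
    · subst hl; simp [e]
    · simp [e, hl]
  have h1 : H.vertex k = d k • G.vertex k + F.comb e := by
    rw [hG.comb_eq (by simp [e]), ← comb_single, ← comb_add, ← hde, hd, comb_repr]
  have h2 := congrArg (fun v => (F.basis hY hn).repr v k) h1
  simp only [map_add, map_smul, Finsupp.add_apply, Finsupp.smul_apply, repr_comb, smul_eq_mul] at h2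
  have he : e k = 0 := by simp [e]
  rw [he, add_zero] at h2
  rw [h2] at hb
  by_contra! hcon
  exact absurd (mul_nonneg_of_nonpos_of_nonpos hcon ha.le) (not_le.2 hb)

-- From an interior point of the facet, a small step away from the vertex `k` leaves the cone of
-- `F`. The cone containing the new point also contains the facet point, if the step is short, and
-- uniqueness forces it to share all the vertices of the facet.
include hY hn in
theorem exists_mate [FiniteDimensional ℝ V] [Finite ι] (hn1 : 1 ≤ n) (F : C.Flag Y n) (k : Fin (n + 1)) :
    ∃ G : C.Flag Y n, G ≠ F ∧ AgreeOff k F G := by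
  classical
  let q : Fin (n + 1) → ℝ := fun l => if l = k then 0 else 1
  have hq : ∀ l, 0 ≤ q l := by
    intro l; simp only [q]; split_ifs <;> norm_num
  -- For n = 0 the facet cone would be the origin, which is not a covered point.
  have hqne : ∃ l, q l ≠ 0 := by
    obtain ⟨l, hl⟩ : ∃ l, l ≠ k := by
      have : Nontrivial (Fin (n + 1)) := Fin.nontrivial_iff_two_le.2 (by omega)
      exact exists_ne k
    exact ⟨l, by simp [q, hl]⟩
  obtain ⟨m, hm, hm0⟩ := exists_last q hq hqne
  have hp : C.Covered (F.comb q) :=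
    F.covered_of_mem_cone hY ⟨q, hq, rfl⟩ (F.comb_equiv hY hq hm hm0).2.2
  obtain ⟨ε, hε, hcov, -, hball⟩ := exists_ball hY hn hp
  set δ := ε / (2 * (‖F.vertex k‖ + 1)) with hδ
  have hδ0 : 0 < δ := by positivity
  have hu : F.comb q - δ • F.vertex k ∈ Metric.ball (F.comb q) ε := by
    rw [Metric.mem_ball, dist_eq_norm, sub_sub_cancel_left, norm_neg, norm_smul,
      Real.norm_of_nonneg hδ0.le, hδ, div_mul_eq_mul_div, div_lt_iff₀ (by positivity)]
    nlinarith [norm_nonneg (F.vertex k)]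
  obtain ⟨G, hG⟩ := exists_mem_cone hY hn (hcov _ hu)
  obtain ⟨t, ht, htp⟩ := hball G _ hu hG
  refine ⟨G, ?_, fun l hl => ?_⟩
  · rintro rfl
    have := (G.mem_cone_iff hY hn _).1 hG k
    rw [map_sub, map_smul, Finsupp.sub_apply, Finsupp.smul_apply, repr_comb,
      ← G.basis_apply hY hn, (G.basis hY hn).repr_self, Finsupp.single_eq_same] at this
    simp only [q, if_true, smul_eq_mul] at this
    linarith
  · exact (comb_unique hY F G hq ht htp).2 l (by simp [q, hl])

/-- Two flags whose cones contain `p` and that share a facet. -/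
def Step (p : V) (F G : C.Flag Y n) : Prop :=
  p ∈ F.cone ∧ p ∈ G.cone ∧ ∃ k, AgreeOff k F G

/-- The span of all vertices but two. -/
def coface (F : C.Flag Y n) (k l : Fin (n + 1)) : Submodule ℝ V :=
  LinearMap.ker ((F.basis hY hn).coord k) ⊓ LinearMap.ker ((F.basis hY hn).coord l)

/-- The coface has codimension two, so one more vector cannot fill the space. -/
theorem coface_sup_ne_top (F : C.Flag Y n) {k l : Fin (n + 1)} (hkl : k ≠ l) (x : V) :
    F.coface hY hn k l ⊔ Submodule.span ℝ {x} ≠ ⊤ := by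
  intro htop
  set φ := (F.basis hY hn).coord k
  set ψ := (F.basis hY hn).coord l
  have key : ∀ v, ∃ c : ℝ, φ v = c * φ x ∧ ψ v = c * ψ x := by
    intro v
    have hv : v ∈ F.coface hY hn k l ⊔ Submodule.span ℝ {x} := htop ▸ Submodule.mem_top
    obtain ⟨w, hw, z, hz, rfl⟩ := Submodule.mem_sup.1 hv
    obtain ⟨c, rfl⟩ := Submodule.mem_span_singleton.1 hz
    refine ⟨c, ?_, ?_⟩
    · rw [map_add, map_smul, smul_eq_mul, show φ w = 0 from hw.1, zero_add]
    · rw [map_add, map_smul, smul_eq_mul, show ψ w = 0 from hw.2, zero_add]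
  obtain ⟨c, hc1, hc2⟩ := key (F.basis hY hn k)
  obtain ⟨d, hd1, hd2⟩ := key (F.basis hY hn l)
  simp only [φ, ψ, Module.Basis.coord_apply, Module.Basis.repr_self, Finsupp.single_eq_same,
    Finsupp.single_apply, hkl, hkl.symm, if_false] at hc1 hc2 hd1 hd2
  rcases mul_eq_zero.1 hc2.symm with h | h
  · rw [h, zero_mul] at hc1; exact one_ne_zero hc1
  · rw [h, mul_zero] at hd2; exact one_ne_zero hd2

include hY hn in
/-- The star of every point is strongly connected. -/
theorem reflTransGen_step [FiniteDimensional ℝ V] [Finite ι] {p : V} (hp : C.Covered p) (F G : C.Flag Y n)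
    (hF : p ∈ F.cone) (hG : p ∈ G.cone) : Relation.ReflTransGen (Step p) F G := by
  classical
  obtain ⟨ε, hε, hcov, hfin, hball⟩ := exists_ball (n := n) hY hn hp
  have hint : ∀ H : C.Flag Y n, p ∈ H.cone →
      IsOpen ({v | ∀ k, 0 < (H.basis hY hn).repr v k} ∩ Metric.ball p ε) ∧
      ({v | ∀ k, 0 < (H.basis hY hn).repr v k} ∩ Metric.ball p ε).Nonempty := by
    intro H hH
    constructor
    · refine IsOpen.inter ?_ Metric.isOpen_ball
      rw [Set.ofPred_forall]
      exact isOpen_iInter_of_finite fun k =>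
        isOpen_lt continuous_const (H.continuous_repr hY hn k)
    · set w := H.comb fun _ => 1
      set δ := ε / (2 * (‖w‖ + 1)) with hδ
      have hδ0 : 0 < δ := by positivity
      refine ⟨p + δ • w, fun k => ?_, ?_⟩
      · rw [map_add, map_smul, Finsupp.add_apply, Finsupp.smul_apply, repr_comb]
        have := (H.mem_cone_iff hY hn p).1 hH k
        simp only [smul_eq_mul, mul_one]
        linarith
      · rw [Metric.mem_ball, dist_eq_norm, add_sub_cancel_left, norm_smul,
          Real.norm_of_nonneg hδ0.le, hδ, div_mul_eq_mul_div, div_lt_iff₀ (by positivity)]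
        nlinarith [norm_nonneg w]
  obtain ⟨x, hxF, hxB⟩ := (hint F hF).2
  set 𝓑 := {H : C.Flag Y n | (H.cone ∩ Metric.ball p ε).Nonempty}
  -- A segment from `x` that meets a codimension-two face after its start ends in the span of that
  -- face and `x`. Choosing the other endpoint outside these subspaces keeps the segment away from
  -- all such faces.
  let S : Set (Submodule ℝ V) := (fun a : C.Flag Y n × Fin (n + 1) × Fin (n + 1) =>
    a.1.coface hY hn a.2.1 a.2.2 ⊔ Submodule.span ℝ {x}) '' {a | a.1 ∈ 𝓑 ∧ a.2.1 ≠ a.2.2}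
  have hS : S.Finite := by
    refine Set.Finite.image _ ((hfin.prod (Set.finite_univ (α := Fin (n + 1) × Fin (n + 1)))).subset ?_)
    exact fun a ha => ⟨ha.1, trivial⟩
  obtain ⟨x', ⟨hx'G, hx'B⟩, hx'S⟩ := exists_mem_open_forall_notMem (hint G hG).1 (hint G hG).2 hS
    (by rintro _ ⟨a, ha, rfl⟩; exact a.1.coface_sup_ne_top hY hn ha.2 x)
  let γ : ℝ → V := fun s => (1 - s) • x + s • x'
  have hγ : Continuous γ := by fun_prop
  have hγB : ∀ s ∈ Set.Icc (0 : ℝ) 1, γ s ∈ Metric.ball p ε := fun s hs =>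
    convex_ball p ε hxB hx'B (by linarith [hs.2]) hs.1 (by ring)
  let E : Set (C.Flag Y n) := {H | H ∈ 𝓑 ∧ Relation.ReflTransGen (Step p) F H}
  let E' : Set (C.Flag Y n) := {H | H ∈ 𝓑 ∧ ¬ Relation.ReflTransGen (Step p) F H}
  have hcl : ∀ A : Set (C.Flag Y n), A ⊆ 𝓑 → IsClosed (γ ⁻¹' ⋃ H ∈ A, H.cone) := fun A hA =>
    ((hfin.subset hA).isClosed_biUnion fun H _ => H.isClosed_cone hY hn).preimage hγ
  by_contra hcon
  have hmem : ∀ (H : C.Flag Y n) v, (∀ k, 0 < (H.basis hY hn).repr v k) → v ∈ H.cone :=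
    fun H v h => (H.mem_cone_iff hY hn v).2 fun k => (h k).le
  have hγ0 : γ 0 = x := by simp [γ]
  have hγ1 : γ 1 = x' := by simp [γ]
  -- The reachable and the unreachable flags would cover the segment by two closed sets, each of
  -- which meets it, so they share a point. That point turns out to lie in a common facet, across
  -- which one more step is possible.
  obtain ⟨s, hs, hsE, hsE'⟩ := isPreconnected_closed_iff.1 (isPreconnected_Icc (a := (0 : ℝ)) (b := 1))
    _ _ (hcl E fun H h => h.1) (hcl E' fun H h => h.1)
    (fun s hs => by
      obtain ⟨H, hH⟩ := exists_mem_cone hY hn (hcov _ (hγB s hs))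
      have hHB : H ∈ 𝓑 := ⟨_, hH, hγB s hs⟩
      by_cases h : Relation.ReflTransGen (Step p) F H
      · exact Or.inl (Set.mem_biUnion (show H ∈ E from ⟨hHB, h⟩) hH)
      · exact Or.inr (Set.mem_biUnion (show H ∈ E' from ⟨hHB, h⟩) hH))
    ⟨0, by simp, by
      rw [Set.mem_preimage, hγ0]
      exact Set.mem_biUnion (show F ∈ E from ⟨⟨x, hmem F x hxF, hxB⟩, .refl⟩) (hmem F x hxF)⟩
    ⟨1, by simp, by
      rw [Set.mem_preimage, hγ1]
      exact Set.mem_biUnion (show G ∈ E' from ⟨⟨x', hmem G x' hx'G, hx'B⟩, hcon⟩)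
        (hmem G x' hx'G)⟩
  simp only [Set.mem_preimage, Set.mem_iUnion] at hsE hsE'
  obtain ⟨H, hHE, t, ht, hHt⟩ := hsE
  obtain ⟨H', hHE', t', ht', hHt'⟩ := hsE'
  obtain ⟨rfl, hvert⟩ := comb_unique hY H H' ht ht' (hHt.symm.trans hHt')
  refine hHE'.2 ?_
  -- At s = 0 the point is `x`, interior to the cone of `F`, with no zero coefficient; for s > 0 the
  -- choice of `x'` applies.
  have hone : ∀ k l, k ≠ l → t k = 0 → t l ≠ 0 := by
    intro k l hkl hk hl
    have hco : γ s ∈ H.coface hY hn k l := by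
      rw [hHt]
      refine ⟨?_, ?_⟩
      · change (H.basis hY hn).repr (H.comb t) k = 0
        rw [repr_comb, hk]
      · change (H.basis hY hn).repr (H.comb t) l = 0
        rw [repr_comb, hl]
    rcases hs.1.eq_or_lt with h0 | h0
    · rw [← h0, hγ0, ← F.comb_repr hY hn x] at hHt
      have := (comb_unique hY F H (fun k => (hxF k).le) ht hHt).1
      have hxk := hxF k
      rw [this, hk] at hxk
      exact hxk.false
    · refine hx'S _ ⟨(H, k, l), ⟨hHE.1, hkl⟩, rfl⟩ ?_
      have : x' = s⁻¹ • γ s + (-(s⁻¹ * (1 - s))) • x := by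
        simp only [γ, smul_add, smul_smul, inv_mul_cancel₀ h0.ne', one_smul, neg_smul]
        abel
      rw [this]
      exact Submodule.add_mem_sup (Submodule.smul_mem _ _ hco)
        (Submodule.smul_mem _ _ (Submodule.mem_span_singleton_self x))
  have hk : ∃ k, ∀ l, l ≠ k → t l ≠ 0 := by
    by_cases h : ∃ k, t k = 0
    · obtain ⟨k, hk⟩ := h
      exact ⟨k, fun l hl => hone k l hl.symm hk⟩
    · push Not at h
      exact ⟨0, fun l _ => h l⟩
  obtain ⟨k, hk⟩ := hk
  have hp' : ∀ K : C.Flag Y n, γ s ∈ K.cone → p ∈ K.cone := fun K hK =>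
    hball K _ (hγB s hs) hK
  exact hHE.2.tail ⟨hp' H ⟨t, ht, hHt⟩, hp' H' ⟨t, ht', hHt'⟩, k, fun l hl => hvert l (hk l hl)⟩

end Flag
end ConeFamily
end Hyperbolic
end

/-! ### Topology of the hyperboloid, geodesic simplices and isometries. -/

noncomputable section
namespace Hyperbolic
open Topology
variable {n : ℕ}

theorem continuous_lorentz : Continuous fun p : Minkowski n × Minkowski n => lorentz p.1 p.2 := by
  unfold lorentz; fun_prop

theorem lorentz_zero_left (v : Minkowski n) : lorentz 0 v = 0 := by simp [lorentz]

theorem lorentz_sub_left (u v w : Minkowski n) :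
    lorentz (u - v) w = lorentz u w - lorentz v w := by
  simp only [lorentz, Prod.fst_sub, Prod.snd_sub, inner_sub_left]; ring

theorem lorentz_sum_right {ι : Type*} (s : Finset ι) (f : ι → Minkowski n) (v : Minkowski n) :
    lorentz v (∑ i ∈ s, f i) = ∑ i ∈ s, lorentz v (f i) := by
  rw [lorentz_comm, lorentz_sum_left]; simp only [lorentz_comm]

theorem eq_zero_of_forall_lorentz {u : Minkowski n} (h : ∀ w, lorentz u w = 0) : u = 0 := by
  have h1 := h (u.1, -u.2)
  simp only [lorentz, inner_neg_right, real_inner_self_eq_norm_sq, sub_neg_eq_add] at h1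
  have h2 : u.1 * u.1 = 0 := by nlinarith [mul_self_nonneg u.1, sq_nonneg ‖u.2‖]
  have h3 : ‖u.2‖ ^ 2 = 0 := by nlinarith
  exact Prod.ext (by simpa using h2) (by simpa using h3)

theorem finrank_minkowski : Module.finrank ℝ (Minkowski n) = n + 1 := by
  simp [Minkowski, add_comm]

namespace HSpace

theorem dist_eq (x y : HSpace n) : dist x y = Real.arcosh (lorentz x.val y.val) := rfl

theorem cosh_dist (x y : HSpace n) : Real.cosh (dist x y) = lorentz x.val y.val :=
  Real.cosh_arcosh (x.one_le_lorentz y)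

theorem val_ne_zero (x : HSpace n) : x.val ≠ 0 := fun h => by
  have := x.time_pos
  rw [h] at this
  exact lt_irrefl _ this

theorem eq_of_val_eq_smul {x y : HSpace n} {c : ℝ} (hc : 0 < c) (h : x.val = c • y.val) :
    x = y := by
  have h1 := x.lorentz_self
  rw [h, lorentz_smul_left, lorentz_smul_right, y.lorentz_self, mul_one] at h1
  have : c = 1 := by nlinarith
  rw [this, one_smul] at h
  exact HSpace.ext h

/-- Splitting a point as p y + u with u orthogonal to y gives ⟨u, u⟩ = 1 - p². The form is negative
definite on the complement of y, so this bounds the Euclidean size of u in terms of p, which is the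
hyperbolic cosine of the distance to y and tends to 1. -/
theorem tendsto_val {α : Type*} {l : Filter α} {f : α → HSpace n} {y : HSpace n}
    (h : Filter.Tendsto f l (𝓝 y)) : Filter.Tendsto (fun a => (f a).val) l (𝓝 y.val) := by
  have hp : Filter.Tendsto (fun a => lorentz (f a).val y.val) l (𝓝 1) := by
    have h1 : Filter.Tendsto (fun a => Real.cosh (dist (f a) y)) l (𝓝 (Real.cosh 0)) :=
      (Real.continuous_cosh.tendsto 0).comp (tendsto_iff_dist_tendsto_zero.1 h)
    simpa only [cosh_dist, Real.cosh_zero] using h1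
  have hbound : ∀ x : HSpace n, ‖(x.val - lorentz x.val y.val • y.val).2‖ ^ 2 ≤
      y.val.1 ^ 2 * (lorentz x.val y.val ^ 2 - 1) ∧
      (x.val - lorentz x.val y.val • y.val).1 ^ 2 ≤
        ‖(x.val - lorentz x.val y.val • y.val).2‖ ^ 2 := by
    intro x
    set p := lorentz x.val y.val with hp
    set u := x.val - p • y.val with hu
    have horth : lorentz u y.val = 0 := by
      rw [hu, lorentz_sub_left, lorentz_smul_left, y.lorentz_self, ← hp]; ring
    have hself : lorentz u u = 1 - p ^ 2 := by
      have : lorentz u u = lorentz u x.val - p * lorentz u y.val := by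
        rw [lorentz_comm u, hu, lorentz_sub_left, lorentz_smul_left, lorentz_comm x.val,
          lorentz_comm y.val]
      rw [this, horth, hu, lorentz_sub_left, lorentz_smul_left, x.lorentz_self,
        lorentz_comm y.val, ← hp]; ring
    have h1 := time_sq_mul_le_of_orthogonal y u horth
    have h2 := lorentz_self_nonpos_of_orthogonal y u horth
    have hy := y.time_sq
    simp only [lorentz, real_inner_self_eq_norm_sq] at hself h2
    constructor
    · nlinarith
    · nlinarith
  have h0 : Filter.Tendsto (fun a => y.val.1 ^ 2 * (lorentz (f a).val y.val ^ 2 - 1)) l (𝓝 0) := by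
    have := ((hp.pow 2).sub_const 1).const_mul (y.val.1 ^ 2)
    simpa using this
  have hsq : ∀ g : α → ℝ, Filter.Tendsto (fun a => g a ^ 2) l (𝓝 0) →
      Filter.Tendsto g l (𝓝 0) := by
    intro g hg
    have := (Real.continuous_sqrt.tendsto 0).comp hg
    simp only [Function.comp_def, Real.sqrt_sq_eq_abs, Real.sqrt_zero] at this
    exact (tendsto_zero_iff_abs_tendsto_zero g).2 this
  have h2 : Filter.Tendsto (fun a => ((f a).val - lorentz (f a).val y.val • y.val).2) l (𝓝 0) := by
    rw [tendsto_zero_iff_norm_tendsto_zero]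
    exact hsq _ (squeeze_zero (fun _ => sq_nonneg _) (fun a => (hbound (f a)).1) h0)
  have h1 : Filter.Tendsto (fun a => ((f a).val - lorentz (f a).val y.val • y.val).1) l (𝓝 0) :=
    hsq _ (squeeze_zero (fun _ => sq_nonneg _)
      (fun a => (hbound (f a)).2.trans (hbound (f a)).1) h0)
  have h3 : Filter.Tendsto (fun a => (f a).val - lorentz (f a).val y.val • y.val) l (𝓝 0) :=
    h1.prodMk_nhds h2
  have h4 := h3.add (hp.smul_const y.val)
  simpa using h4

theorem continuous_val : Continuous (HSpace.val : HSpace n → Minkowski n) :=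
  continuous_iff_continuousAt.2 fun _ => tendsto_val Filter.tendsto_id

theorem isInducing_val : IsInducing (HSpace.val : HSpace n → Minkowski n) := by
  refine isInducing_iff_nhds.2 fun y => le_antisymm (continuous_val.tendsto y).le_comap ?_
  have h : Filter.Tendsto (id : HSpace n → HSpace n) (Filter.comap HSpace.val (𝓝 y.val)) (𝓝 y) := by
    rw [tendsto_iff_dist_tendsto_zero]
    have h1 : Filter.Tendsto (fun x : HSpace n => lorentz x.val y.val)
        (Filter.comap HSpace.val (𝓝 y.val)) (𝓝 1) := by
      have h2 : Filter.Tendsto (fun v => lorentz v y.val) (𝓝 y.val) (𝓝 1) := by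
        have : Continuous fun v : Minkowski n => lorentz v y.val :=
          continuous_lorentz.comp (by fun_prop : Continuous fun v : Minkowski n => (v, y.val))
        simpa only [y.lorentz_self] using this.tendsto y.val
      exact h2.comp Filter.tendsto_comap
    have h3 : ContinuousWithinAt Real.arcosh (Set.Ici 1) 1 :=
      Real.continuousOn_arcosh.continuousWithinAt (by simp)
    have h4 : Filter.Tendsto (fun x : HSpace n => lorentz x.val y.val)
        (Filter.comap HSpace.val (𝓝 y.val)) (𝓝[Set.Ici 1] 1) :=
      tendsto_nhdsWithin_iff.2 ⟨h1, Filter.Eventually.of_forall fun x => x.one_le_lorentz y⟩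
    have h5 := h3.tendsto.comp h4
    rw [Real.arcosh_zero] at h5
    exact h5
  exact h

theorem isClosedEmbedding_val : IsClosedEmbedding (HSpace.val : HSpace n → Minkowski n) := by
  refine ⟨⟨isInducing_val, fun x y h => HSpace.ext h⟩, ?_⟩
  have : Set.range (HSpace.val : HSpace n → Minkowski n) =
      {v | lorentz v v = 1} ∩ {v | 0 ≤ v.1} := by
    ext v
    constructor
    · rintro ⟨x, rfl⟩
      exact ⟨x.lorentz_self, x.time_pos.le⟩
    · rintro ⟨h1, h2⟩
      refine ⟨⟨v, h1, lt_of_le_of_ne h2 fun h => ?_⟩, rfl⟩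
      simp only [Set.mem_ofPred_eq, lorentz, real_inner_self_eq_norm_sq, ← h] at h1
      nlinarith [sq_nonneg ‖v.2‖]
  rw [this]
  exact (isClosed_eq (continuous_lorentz.comp (by fun_prop : Continuous fun v : Minkowski n => (v, v)))
    continuous_const).inter (isClosed_le continuous_const continuous_fst)

/-- Together with proper discontinuity this makes the quotient Hausdorff. -/
instance : LocallyCompactSpace (HSpace n) := isClosedEmbedding_val.locallyCompactSpace

/-- The midpoint is x + y rescaled to the hyperboloid; the duplication formula for cosh gives the
distances. -/
theorem exists_midpoint (x y : HSpace n) :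
    ∃ m : HSpace n, dist m x = dist x y / 2 ∧ dist m y = dist x y / 2 := by
  set d := dist x y with hd
  have hxy : lorentz x.val y.val = 2 * Real.cosh (d / 2) ^ 2 - 1 := by
    rw [← cosh_dist, ← hd]
    have := Real.cosh_two_mul (d / 2)
    rw [mul_div_cancel₀ d two_ne_zero] at this
    rw [this, Real.sinh_sq]; ring
  have hc := Real.cosh_pos (d / 2)
  have hself : lorentz (x.val + y.val) (x.val + y.val) = (2 * Real.cosh (d / 2)) ^ 2 := by
    simp only [lorentz_add_left, lorentz_add_right, x.lorentz_self, y.lorentz_self,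
      lorentz_comm y.val x.val, hxy]; ring
  let m := normalize (x.val + y.val) (by rw [hself]; positivity) (add_pos x.time_pos y.time_pos)
  have hm : m.val = (2 * Real.cosh (d / 2))⁻¹ • (x.val + y.val) := by
    simp only [m, normalize, hself, Real.sqrt_sq (by positivity : 0 ≤ 2 * Real.cosh (d / 2))]
  have hd0 : 0 ≤ d / 2 := by positivity
  have key : (2 * Real.cosh (d / 2))⁻¹ * (1 + (2 * Real.cosh (d / 2) ^ 2 - 1)) = Real.cosh (d / 2) := by
    field_simp
    ring
  refine ⟨m, ?_, ?_⟩
  · rw [dist_eq, hm, lorentz_smul_left, lorentz_add_left, x.lorentz_self, lorentz_comm y.val, hxy,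
      key, Real.arcosh_cosh hd0]
  · rw [dist_eq, hm, lorentz_smul_left, lorentz_add_left, y.lorentz_self, hxy,
      add_comm, key, Real.arcosh_cosh hd0]

end HSpace

namespace GeodesicSimplex

/-- The vertices of a geodesic simplex as a basis of Minkowski space. -/
def basis (Δ : GeodesicSimplex n) : Module.Basis (Fin (n + 1)) ℝ (Minkowski n) :=
  basisOfLinearIndependentOfCardEqFinrank Δ.linearIndependent (by rw [finrank_minkowski, Fintype.card_fin])

theorem basis_apply (Δ : GeodesicSimplex n) (k : Fin (n + 1)) :
    Δ.basis k = (Δ.vertex k).val := by simp [basis]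

theorem sum_repr (Δ : GeodesicSimplex n) (v : Minkowski n) :
    ∑ k, Δ.basis.repr v k • (Δ.vertex k).val = v := by
  simpa only [basis_apply] using Δ.basis.sum_repr v

theorem repr_sum (Δ : GeodesicSimplex n) (c : Fin (n + 1) → ℝ) (k : Fin (n + 1)) :
    Δ.basis.repr (∑ k, c k • (Δ.vertex k).val) k = c k := by
  simp only [← basis_apply, Δ.basis.repr_sum_self]

theorem eq_zero_of_lorentz_vertex (Δ : GeodesicSimplex n) {u : Minkowski n}
    (h : ∀ k, lorentz u (Δ.vertex k).val = 0) : u = 0 := by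
  refine eq_zero_of_forall_lorentz fun w => ?_
  rw [← Δ.sum_repr w, lorentz_sum_right]
  exact Finset.sum_eq_zero fun k _ => by rw [lorentz_smul_right, h k, mul_zero]

theorem exists_param_val (Δ : GeodesicSimplex n) (t : stdSimplex ℝ (Fin (n + 1))) :
    ∃ c : ℝ, 0 < c ∧ (Δ.param t).val = c • ∑ k, t.1 k • (Δ.vertex k).val :=
  ⟨_, inv_pos.2 (Real.sqrt_pos.2 (Δ.lorentz_combination_pos t)), rfl⟩

theorem exists_smul_combination (Δ : GeodesicSimplex n) {v : Minkowski n} (hv : v ≠ 0)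
    (h : ∀ k, 0 ≤ Δ.basis.repr v k) :
    ∃ c : ℝ, 0 < c ∧ ∃ t : stdSimplex ℝ (Fin (n + 1)),
      (∀ k, Δ.basis.repr v k = c * t.1 k) ∧ v = c • Δ.combination t := by
  set c := ∑ k, Δ.basis.repr v k with hc
  have hc0 : 0 < c := by
    refine lt_of_le_of_ne (Finset.sum_nonneg fun k _ => h k) fun h0 => hv ?_
    rw [← Δ.sum_repr v]
    refine Finset.sum_eq_zero fun k _ => ?_
    rw [(Finset.sum_eq_zero_iff_of_nonneg fun k _ => h k).1 h0.symm k (Finset.mem_univ k), zero_smul]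
  have hk : ∀ k, Δ.basis.repr v k = c * (Δ.basis.repr v k / c) := fun k => by field_simp
  refine ⟨c, hc0, ⟨fun k => Δ.basis.repr v k / c, fun k => div_nonneg (h k) hc0.le, ?_⟩, hk, ?_⟩
  · rw [← Finset.sum_div, ← hc, div_self hc0.ne']
  · rw [combination, Finset.smul_sum]
    conv_lhs => rw [← Δ.sum_repr v]
    exact Finset.sum_congr rfl fun k _ => by rw [smul_smul, ← hk]

theorem exists_smul_param (Δ : GeodesicSimplex n) {v : Minkowski n} (hv : v ≠ 0)
    (h : ∀ k, 0 ≤ Δ.basis.repr v k) :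
    ∃ c : ℝ, 0 < c ∧ ∃ t : stdSimplex ℝ (Fin (n + 1)),
      (∀ k, 0 < Δ.basis.repr v k → 0 < t.1 k) ∧ v = c • (Δ.param t).val := by
  obtain ⟨c, hc, t, ht, hvc⟩ := Δ.exists_smul_combination hv h
  obtain ⟨d, hd, hdt⟩ := Δ.exists_param_val t
  refine ⟨c / d, div_pos hc hd, t, fun k hk => ?_, ?_⟩
  · rw [ht k] at hk
    exact (pos_iff_pos_of_mul_pos hk).1 hc
  · rw [hdt, smul_smul, div_mul_cancel₀ _ hd.ne']
    exact hvc

theorem repr_param (Δ : GeodesicSimplex n) (t : stdSimplex ℝ (Fin (n + 1))) :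
    ∃ c : ℝ, 0 < c ∧ ∀ k, Δ.basis.repr (Δ.param t).val k = c * t.1 k := by
  obtain ⟨c, hc, h⟩ := Δ.exists_param_val t
  refine ⟨c, hc, fun k => ?_⟩
  rw [h, map_smul, Finsupp.smul_apply, repr_sum, smul_eq_mul]

theorem mem_carrier_iff (Δ : GeodesicSimplex n) (x : HSpace n) :
    x ∈ Δ.carrier ↔ ∀ k, 0 ≤ Δ.basis.repr x.val k := by
  constructor
  · rintro ⟨t, rfl⟩ k
    obtain ⟨c, hc, h⟩ := Δ.repr_param t
    rw [h]; exact mul_nonneg hc.le (t.2.1 k)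
  · intro h
    obtain ⟨c, hc, t, -, hx⟩ := Δ.exists_smul_param x.val_ne_zero h
    exact ⟨t, (HSpace.eq_of_val_eq_smul hc hx).symm⟩

theorem mem_openCarrier_iff (Δ : GeodesicSimplex n) (x : HSpace n) :
    x ∈ Δ.openCarrier ↔ ∀ k, 0 < Δ.basis.repr x.val k := by
  constructor
  · rintro ⟨t, ht, rfl⟩ k
    obtain ⟨c, hc, h⟩ := Δ.repr_param t
    rw [h]; exact mul_pos hc (ht k)
  · intro h
    obtain ⟨c, hc, t, ht, hx⟩ := Δ.exists_smul_param x.val_ne_zero fun k => (h k).le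
    exact ⟨t, fun k => ht k (h k), (HSpace.eq_of_val_eq_smul hc hx).symm⟩

theorem continuous_param (Δ : GeodesicSimplex n) : Continuous Δ.param := by
  rw [HSpace.isInducing_val.continuous_iff]
  have hc : Continuous Δ.combination := continuous_finsetSum _ fun k _ =>
    ((continuous_apply k).comp continuous_subtype_val).smul continuous_const
  have hl : Continuous fun t => lorentz (Δ.combination t) (Δ.combination t) :=
    continuous_lorentz.comp (hc.prodMk hc)
  exact (hl.sqrt.inv₀ fun t => (Real.sqrt_pos.2 (Δ.lorentz_combination_pos t)).ne').smul hc

theorem isCompact_carrier (Δ : GeodesicSimplex n) : IsCompact Δ.carrier :=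
  isCompact_range Δ.continuous_param

end GeodesicSimplex

section Isometries

variable {Γ : Type*} [Group Γ] [MulAction Γ (HSpace n)]

theorem proj_eq_iff {x y : HSpace n} : proj Γ x = proj Γ y ↔ ∃ γ : Γ, γ • y = x := by
  rw [proj, proj, Quotient.eq]; rfl

/-- A ball about the midpoint of `x` and `γ • x` with radius above half their distance contains
both, and the projection identifies them. -/
theorem two_mul_injectivityRadius_le {x : HSpace n} {γ : Γ} (h : γ • x ≠ x) :
    2 * injectivityRadius n Γ ≤ ENNReal.ofReal (dist (γ • x) x) := by
  obtain ⟨m, hm1, hm2⟩ := HSpace.exists_midpoint (γ • x) x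
  have h1 : injectivityRadius n Γ ≤ ENNReal.ofReal (dist (γ • x) x / 2) := by
    refine (iInf_le _ m).trans (iSup₂_le fun r hr => ?_)
    by_contra! hlt
    have hlt' : dist (γ • x) x / 2 < r := by
      rwa [← ENNReal.ofReal_coe_nnreal, ENNReal.ofReal_lt_ofReal_iff_of_nonneg (by positivity)] at hlt
    refine h (hr ?_ ?_ (proj_eq_iff.2 ⟨γ, rfl⟩))
    · rw [Metric.mem_ball']; linarith
    · rw [Metric.mem_ball']; linarith
  calc 2 * injectivityRadius n Γ ≤ 2 * ENNReal.ofReal (dist (γ • x) x / 2) := by gcongr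
    _ = ENNReal.ofReal (dist (γ • x) x) := by
      rw [← ENNReal.ofReal_ofNat 2, ← ENNReal.ofReal_mul (by norm_num),
        mul_div_cancel₀ _ two_ne_zero]

variable [IsIsometricSMul Γ (HSpace n)]

theorem lorentz_smul_smul (γ : Γ) (x y : HSpace n) :
    lorentz (γ • x).val (γ • y).val = lorentz x.val y.val := by
  rw [← HSpace.cosh_dist, dist_smul, HSpace.cosh_dist]

namespace GeodesicSimplex

/-- The image of a geodesic simplex under an isometry. -/
def translate (γ : Γ) (Δ : GeodesicSimplex n) : GeodesicSimplex n where
  vertex k := γ • Δ.vertex k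
  linearIndependent := by
    rw [Fintype.linearIndependent_iff]
    intro g hg
    refine Fintype.linearIndependent_iff.1 Δ.linearIndependent g
      (Δ.eq_zero_of_lorentz_vertex fun j => ?_)
    have h := congrArg (fun v => lorentz v (γ • Δ.vertex j).val) hg
    simpa only [lorentz_sum_left, lorentz_smul_left, lorentz_smul_smul, lorentz_zero_left] using h

end GeodesicSimplex

/-- Isometries of hyperbolic space are restrictions of linear maps. -/
theorem exists_linearMap (Δ : GeodesicSimplex n) (γ : Γ) :
    ∃ A : Minkowski n →ₗ[ℝ] Minkowski n, ∀ x : HSpace n, (γ • x).val = A x.val := by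
  let A := Δ.basis.constr ℝ fun k => (γ • Δ.vertex k).val
  have hA : ∀ k, A (Δ.vertex k).val = (γ • Δ.vertex k).val := fun k => by
    rw [← Δ.basis_apply, Module.Basis.constr_basis]
  refine ⟨A, fun x => ?_⟩
  rw [← sub_eq_zero]
  -- The form is nondegenerate and preserved by `γ`, so it suffices to pair with the translated
  -- vertices.
  refine (Δ.translate γ).eq_zero_of_lorentz_vertex fun j => ?_
  have h : A x.val = ∑ k, Δ.basis.repr x.val k • (γ • Δ.vertex k).val := by
    conv_lhs => rw [← Δ.sum_repr x.val]
    simp only [map_sum, map_smul, hA]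
  have h2 : lorentz x.val (Δ.vertex j).val =
      ∑ k, Δ.basis.repr x.val k * lorentz (Δ.vertex k).val (Δ.vertex j).val := by
    conv_lhs => rw [← Δ.sum_repr x.val]
    simp only [lorentz_sum_left, lorentz_smul_left]
  simp only [GeodesicSimplex.translate, lorentz_sub_left, h, lorentz_sum_left, lorentz_smul_left,
    lorentz_smul_smul, h2, sub_self]

theorem GeodesicSimplex.repr_translate (Δ : GeodesicSimplex n) {γ : Γ}
    {A : Minkowski n →ₗ[ℝ] Minkowski n} (hA : ∀ x : HSpace n, (γ • x).val = A x.val)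
    (v : Minkowski n) (k : Fin (n + 1)) :
    (Δ.translate γ).basis.repr (A v) k = Δ.basis.repr v k := by
  have h : A v = ∑ m, Δ.basis.repr v m • ((Δ.translate γ).vertex m).val := by
    conv_lhs => rw [← Δ.sum_repr v]
    simp only [map_sum, map_smul, ← hA]; rfl
  rw [h, (Δ.translate γ).repr_sum]

theorem GeodesicSimplex.repr_translate_smul (Δ : GeodesicSimplex n) (γ : Γ)
    (x : HSpace n) (k : Fin (n + 1)) :
    (Δ.translate γ).basis.repr (γ • x).val k = Δ.basis.repr x.val k := by
  obtain ⟨A, hA⟩ := exists_linearMap Δ γ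
  rw [hA, Δ.repr_translate hA]

theorem GeodesicSimplex.translate_param (Δ : GeodesicSimplex n) (γ : Γ)
    (t : stdSimplex ℝ (Fin (n + 1))) : (Δ.translate γ).param t = γ • Δ.param t := by
  obtain ⟨A, hA⟩ := exists_linearMap Δ γ
  obtain ⟨c, hc, h⟩ := Δ.exists_param_val t
  obtain ⟨d, hd, h'⟩ := (Δ.translate γ).exists_param_val t
  refine HSpace.eq_of_val_eq_smul (div_pos hd hc) ?_
  rw [hA, h, h', map_smul, map_sum, smul_smul, div_mul_cancel₀ _ hc.ne']
  simp only [map_smul, ← hA]; rfl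

end Isometries

end Hyperbolic
end

/-! ### The cones over the lifted simplices and the number of their cells. -/

noncomputable section
namespace Hyperbolic
open Topology
variable {n T : ℕ} {Γ : Type*} [Group Γ] [MulAction Γ (HSpace n)] [IsIsometricSMul Γ (HSpace n)]

theorem GeodesicSimplex.translate_mul (γ g : Γ) (Δ : GeodesicSimplex n) :
    Δ.translate (γ * g) = (Δ.translate g).translate γ := by
  simp only [translate, mul_smul]

theorem GeodesicSimplex.smul_mem_carrier_translate (Δ : GeodesicSimplex n) (γ : Γ)
    (x : HSpace n) : γ • x ∈ (Δ.translate γ).carrier ↔ x ∈ Δ.carrier := by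
  simp only [mem_carrier_iff, repr_translate_smul]

theorem GeodesicSimplex.smul_mem_openCarrier_translate (Δ : GeodesicSimplex n) (γ : Γ)
    (x : HSpace n) : γ • x ∈ (Δ.translate γ).openCarrier ↔ x ∈ Δ.openCarrier := by
  simp only [mem_openCarrier_iff, repr_translate_smul]

theorem GeodesicSimplex.mem_carrier_translate (Δ : GeodesicSimplex n) (γ : Γ)
    (x : HSpace n) : x ∈ (Δ.translate γ).carrier ↔ γ⁻¹ • x ∈ Δ.carrier := by
  rw [← smul_mem_carrier_translate Δ γ, smul_inv_smul]

theorem GeodesicSimplex.mem_openCarrier_translate (Δ : GeodesicSimplex n) (γ : Γ)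
    (x : HSpace n) : x ∈ (Δ.translate γ).openCarrier ↔ γ⁻¹ • x ∈ Δ.openCarrier := by
  rw [← smul_mem_openCarrier_translate Δ γ, smul_inv_smul]

variable (Γ) in
/-- The translates of the simplices `Δ j` cover hyperbolic space, and are small in comparison
with the displacement of the elements of `Γ`. -/
structure SmallCover (Δ : Fin T → GeodesicSimplex n) (ρ : ℝ) : Prop where
  pos : 0 < ρ
  cover : ∀ x : HSpace n, ∃ (γ : Γ) (j : Fin T), x ∈ ((Δ j).translate γ).carrier
  diam : ∀ j, ∀ x ∈ (Δ j).carrier, ∀ y ∈ (Δ j).carrier, dist x y ≤ ρ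
  displacement : ∀ γ : Γ, γ ≠ 1 → ∀ x : HSpace n, 4 * ρ ≤ dist (γ • x) x

theorem exists_smallCover [IsCancelSMul Γ (HSpace n)] (hn : 1 ≤ n)
    (Δ : Fin T → GeodesicSimplex n) (hcov : (⋃ j, proj Γ '' (Δ j).carrier) = Set.univ)
    (hdiam : ∀ j, Metric.ediam (Δ j).carrier ≤ injectivityRadius n Γ / 2) :
    ∃ ρ, SmallCover Γ Δ ρ := by
  have hcover : ∀ x : HSpace n, ∃ (γ : Γ) (j : Fin T), x ∈ ((Δ j).translate γ).carrier := by
    intro x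
    have hx : proj Γ x ∈ ⋃ j, proj Γ '' (Δ j).carrier := hcov ▸ Set.mem_univ _
    obtain ⟨j, y, hy, hyx⟩ := Set.mem_iUnion.1 hx
    obtain ⟨γ, hγ⟩ := proj_eq_iff.1 hyx
    refine ⟨γ⁻¹, j, ?_⟩
    rw [GeodesicSimplex.mem_carrier_translate, inv_inv, hγ]
    exact hy
  obtain ⟨-, j0, -⟩ := hcover ⟨((1 : ℝ), 0), by simp [lorentz], by simp⟩
  have : Nonempty (Fin T) := ⟨j0⟩
  obtain ⟨j1, hj1⟩ := Finite.exists_max fun j => Metric.diam (Δ j).carrier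
  have hle : ∀ j, ∀ x ∈ (Δ j).carrier, ∀ y ∈ (Δ j).carrier,
      dist x y ≤ Metric.diam (Δ j1).carrier := fun j x hx y hy =>
    (Metric.dist_le_diam_of_mem (Δ j).isCompact_carrier.isBounded hx hy).trans (hj1 j)
  refine ⟨Metric.diam (Δ j1).carrier, ?_, hcover, hle, fun γ hγ x => ?_⟩
  -- Since n ≥ 1, a simplex has two distinct vertices, so the largest diameter is positive.
  · have h01 : (0 : Fin (n + 1)) ≠ Fin.last n := by
      intro h; have := congrArg Fin.val h; simp at this; omega
    have hv : ∀ k, (Δ j1).vertex k ∈ (Δ j1).carrier := by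
      intro k
      rw [GeodesicSimplex.mem_carrier_iff, ← GeodesicSimplex.basis_apply]
      intro m
      rw [Module.Basis.repr_self, Finsupp.single_apply]
      split_ifs <;> norm_num
    refine lt_of_lt_of_le (dist_pos.2 fun h => h01 ?_) (hle j1 _ (hv 0) _ (hv (Fin.last n)))
    exact (Δ j1).linearIndependent.injective (congrArg HSpace.val h)
  -- Freeness, then two factors of 2: twice the diameter is at most the injectivity radius, and
  -- twice the latter is at most the displacement.
  · have hne : γ • x ≠ x := fun h => hγ (by
      have : γ • x = (1 : Γ) • x := by rw [h, one_smul]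
      exact IsCancelSMul.right_cancel _ _ _ this)
    have h1 := two_mul_injectivityRadius_le hne
    have h2 : 2 * Metric.ediam (Δ j1).carrier ≤ injectivityRadius n Γ := by
      calc 2 * Metric.ediam (Δ j1).carrier ≤ 2 * (injectivityRadius n Γ / 2) := by
            gcongr; exact hdiam j1
        _ = injectivityRadius n Γ := ENNReal.mul_div_cancel two_ne_zero ENNReal.ofNat_ne_top
    have h3 : 4 * Metric.ediam (Δ j1).carrier ≤ ENNReal.ofReal (dist (γ • x) x) := by
      refine le_trans ?_ h1
      calc 4 * Metric.ediam (Δ j1).carrier = 2 * (2 * Metric.ediam (Δ j1).carrier) := by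
            rw [← mul_assoc]; norm_num
        _ ≤ _ := by gcongr
    have h4 := ENNReal.toReal_mono ENNReal.ofReal_ne_top h3
    rwa [ENNReal.toReal_mul, ENNReal.toReal_ofNat, ENNReal.toReal_ofReal dist_nonneg] at h4

variable (Γ) in
/-- The cones over the translates of the simplices `Δ j`. -/
def liftFamily (Δ : Fin T → GeodesicSimplex n) :
    ConeFamily (Minkowski n) (Γ × Fin T) (Fin (n + 1)) where
  coord l k := ((Δ l.2).translate l.1).basis.coord k
  pointed l v h := by
    rw [← ((Δ l.2).translate l.1).sum_repr v]
    exact Finset.sum_eq_zero fun k _ => by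
      rw [show ((Δ l.2).translate l.1).basis.repr v k = 0 from h k, zero_smul]

variable {Δ : Fin T → GeodesicSimplex n} {ρ : ℝ}

open ConeFamily

theorem mem_support_iff (l : Γ × Fin T) (x : HSpace n) :
    l ∈ (liftFamily Γ Δ).support x.val ↔ x ∈ ((Δ l.2).translate l.1).carrier :=
  (GeodesicSimplex.mem_carrier_iff _ _).symm

theorem support_smul {c : ℝ} (hc : 0 < c) (v : Minkowski n) :
    (liftFamily Γ Δ).support (c • v) = (liftFamily Γ Δ).support v := by
  ext l
  simp only [support, Set.mem_ofPred_eq, map_smul, smul_eq_mul, mul_nonneg_iff_of_pos_left hc]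

theorem exists_smul_val {v : Minkowski n} (hv : (liftFamily Γ Δ).Covered v) :
    ∃ c : ℝ, 0 < c ∧ ∃ x : HSpace n, v = c • x.val := by
  obtain ⟨hv0, l, hl⟩ := hv
  obtain ⟨c, hc, t, -, h⟩ := ((Δ l.2).translate l.1).exists_smul_param hv0 hl
  exact ⟨c, hc, _, h⟩

theorem coord_smul (γ : Γ) (l : Γ × Fin T) (k : Fin (n + 1)) (x : HSpace n) :
    (liftFamily Γ Δ).coord l k (γ • x).val = (liftFamily Γ Δ).coord (γ⁻¹ * l.1, l.2) k x.val := by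
  have h := ((Δ l.2).translate (γ⁻¹ * l.1)).repr_translate_smul γ x k
  rw [← GeodesicSimplex.translate_mul, mul_inv_cancel_left] at h
  exact h

theorem mem_support_smul (γ : Γ) (l : Γ × Fin T) (x : HSpace n) :
    l ∈ (liftFamily Γ Δ).support (γ • x).val ↔
      (γ⁻¹ * l.1, l.2) ∈ (liftFamily Γ Δ).support x.val := by
  simp only [support, Set.mem_ofPred_eq, coord_smul]

theorem mem_near_iff (l : Γ × Fin T) (v : Minkowski n) :
    l ∈ (liftFamily Γ Δ).near v ↔ ∃ l' ∈ (liftFamily Γ Δ).support v, ∃ y : HSpace n,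
      l ∈ (liftFamily Γ Δ).support y.val ∧ l' ∈ (liftFamily Γ Δ).support y.val := by
  constructor
  · rintro ⟨l', hl', w, hw, h1, h2⟩
    obtain ⟨c, hc, y, rfl⟩ := exists_smul_val ⟨hw, l, h1⟩
    rw [support_smul hc] at h1 h2
    exact ⟨l', hl', y, h1, h2⟩
  · rintro ⟨l', hl', y, h1, h2⟩
    exact ⟨l', hl', y.val, y.val_ne_zero, h1, h2⟩

theorem mem_near_smul (γ : Γ) (l : Γ × Fin T) (x : HSpace n)
    (h : l ∈ (liftFamily Γ Δ).near (γ • x).val) :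
    (γ⁻¹ * l.1, l.2) ∈ (liftFamily Γ Δ).near x.val := by
  obtain ⟨l', hl', y, h1, h2⟩ := (mem_near_iff _ _).1 h
  refine (mem_near_iff _ _).2 ⟨(γ⁻¹ * l'.1, l'.2), (mem_support_smul γ l' x).1 hl', γ⁻¹ • y, ?_, ?_⟩
  · rw [← mem_support_smul, smul_inv_smul]; exact h1
  · rw [← mem_support_smul, smul_inv_smul]; exact h2

theorem faceOf_smul (γ : Γ) {x y : HSpace n} (h : (liftFamily Γ Δ).FaceOf x.val y.val) :
    (liftFamily Γ Δ).FaceOf (γ • x).val (γ • y).val := by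
  intro l hl k
  rw [coord_smul, coord_smul]
  exact h _ (mem_near_smul γ l y hl) k

/-- `x` and `y` lie in the same cell. -/
def SameCell (Γ : Type*) [Group Γ] [MulAction Γ (HSpace n)] [IsIsometricSMul Γ (HSpace n)]
    (Δ : Fin T → GeodesicSimplex n) (x y : HSpace n) : Prop :=
  (liftFamily Γ Δ).FaceOf x.val y.val ∧ (liftFamily Γ Δ).FaceOf y.val x.val

theorem SameCell.smul (γ : Γ) {x y : HSpace n} (h : SameCell Γ Δ x y) :
    SameCell Γ Δ (γ • x) (γ • y) := ⟨faceOf_smul γ h.1, faceOf_smul γ h.2⟩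

theorem SameCell.symm {x y : HSpace n} (h : SameCell Γ Δ x y) : SameCell Γ Δ y x := ⟨h.2, h.1⟩

theorem SameCell.trans {x y z : HSpace n} (h : SameCell Γ Δ x y) (h' : SameCell Γ Δ y z) :
    SameCell Γ Δ x z :=
  ⟨h.1.trans h'.1 z.val_ne_zero, h'.2.trans h.2 x.val_ne_zero⟩

theorem SameCell.support_eq {x y : HSpace n} (h : SameCell Γ Δ x y) :
    (liftFamily Γ Δ).support x.val = (liftFamily Γ Δ).support y.val :=
  (h.2.support_subset x.val_ne_zero).antisymm (h.1.support_subset y.val_ne_zero)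

/-- Cells up to the action of `Γ`. -/
def cellSetoid (Γ : Type*) [Group Γ] [MulAction Γ (HSpace n)] [IsIsometricSMul Γ (HSpace n)]
    (Δ : Fin T → GeodesicSimplex n) : Setoid (HSpace n) where
  r x y := ∃ γ : Γ, SameCell Γ Δ (γ • x) y
  iseqv := by
    refine ⟨fun x => ⟨1, by rw [one_smul]; exact ⟨.refl _, .refl _⟩⟩, ?_, ?_⟩
    · rintro x y ⟨γ, h⟩
      refine ⟨γ⁻¹, ?_⟩
      simpa using (h.smul γ⁻¹).symm
    · rintro x y z ⟨γ, h⟩ ⟨γ', h'⟩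
      refine ⟨γ' * γ, ?_⟩
      rw [mul_smul]
      exact (h.smul γ').trans h'

/-- A `Γ`-invariant choice of one point in each cell. -/
def centers (Γ : Type*) [Group Γ] [MulAction Γ (HSpace n)] [IsIsometricSMul Γ (HSpace n)]
    (Δ : Fin T → GeodesicSimplex n) : Set (Minkowski n) :=
  {v | ∃ (γ : Γ) (q : Quotient (cellSetoid Γ Δ)), v = (γ • q.out).val}

theorem smul_mem_centers (γ : Γ) {x : HSpace n} (h : x.val ∈ centers Γ Δ) :
    (γ • x).val ∈ centers Γ Δ := by
  obtain ⟨γ', q, hq⟩ := h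
  rw [HSpace.ext hq]
  exact ⟨γ * γ', q, by rw [mul_smul]⟩

variable (Γ Δ) in
/-- The translates that contain `v`, and the signs of the coordinates near `v`. -/
def code (v : Minkowski n) : Set (Fin T) × (Fin T → Fin (n + 1) → SignType) :=
  open Classical in
  ({j | ∃ γ : Γ, (γ, j) ∈ (liftFamily Γ Δ).support v},
    -- In a small cover the chosen translate is the only candidate at points of hyperbolic space;
    -- the value 0 is a filler for indices without a nearby translate.
    fun j k => if h : ∃ γ : Γ, (γ, j) ∈ (liftFamily Γ Δ).near v then
      SignType.sign ((liftFamily Γ Δ).coord (h.choose, j) k v) else 0)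

namespace SmallCover

variable (hS : SmallCover Γ Δ ρ)
include hS

theorem dist_le {l : Γ × Fin T} {x y : HSpace n} (hx : x ∈ ((Δ l.2).translate l.1).carrier)
    (hy : y ∈ ((Δ l.2).translate l.1).carrier) : dist x y ≤ ρ := by
  rw [GeodesicSimplex.mem_carrier_translate] at hx hy
  simpa using hS.diam l.2 _ hx _ hy

theorem eq_of_dist_lt {γ γ' : Γ} {x : HSpace n} (h : dist (γ • x) (γ' • x) < 4 * ρ) :
    γ = γ' := by
  by_contra hne
  have := hS.displacement (γ'⁻¹ * γ) (fun h => hne (inv_mul_eq_one.1 h).symm) x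
  rw [← dist_smul γ', ← mul_smul, mul_inv_cancel_left] at this
  linarith

/-- Only one translate of each simplex passes near a given place. -/
theorem lift_unique {l l' : Γ × Fin T} (hj : l.2 = l'.2) {x y : HSpace n}
    (hx : x ∈ ((Δ l.2).translate l.1).carrier) (hy : y ∈ ((Δ l'.2).translate l'.1).carrier)
    (h : dist x y < 3 * ρ) : l = l' := by
  obtain ⟨γ, j⟩ := l
  obtain ⟨γ', j'⟩ := l'
  obtain rfl : j = j' := hj
  simp only [GeodesicSimplex.mem_carrier_translate] at hx hy
  -- The point γ' γ⁻¹ x lies in the same translate as `y`, so within ρ of it, and therefore within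
  -- less than 4ρ of `x`.
  have h1 := hS.diam j _ hx _ hy
  rw [← dist_smul γ', smul_inv_smul] at h1
  have h2 : dist (γ • γ⁻¹ • x) (γ' • γ⁻¹ • x) < 4 * ρ := by
    rw [smul_inv_smul]
    linarith [dist_triangle x y (γ' • γ⁻¹ • x), dist_comm y (γ' • γ⁻¹ • x)]
  rw [hS.eq_of_dist_lt h2]

theorem exists_of_mem_near {l : Γ × Fin T} {x : HSpace n}
    (hl : l ∈ (liftFamily Γ Δ).near x.val) :
    ∃ y ∈ ((Δ l.2).translate l.1).carrier, dist x y ≤ ρ := by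
  obtain ⟨l', hl', y, h1, h2⟩ := (mem_near_iff _ _).1 hl
  rw [mem_support_iff] at hl' h1 h2
  exact ⟨y, h1, hS.dist_le hl' h2⟩

/-- A translate near `x` contains a point within ρ of `x`; two such points are at most 2ρ < 3ρ
apart. -/
theorem near_unique {l l' : Γ × Fin T} {x : HSpace n} (hl : l ∈ (liftFamily Γ Δ).near x.val)
    (hl' : l' ∈ (liftFamily Γ Δ).near x.val) (hj : l.2 = l'.2) : l = l' := by
  obtain ⟨y, hy, hxy⟩ := hS.exists_of_mem_near hl
  obtain ⟨y', hy', hxy'⟩ := hS.exists_of_mem_near hl'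
  refine hS.lift_unique hj hy hy' ?_
  linarith [dist_triangle_left y y' x, hS.pos]

theorem covered (x : HSpace n) : (liftFamily Γ Δ).Covered x.val := by
  obtain ⟨γ, j, h⟩ := hS.cover x
  exact ⟨x.val_ne_zero, (γ, j), (mem_support_iff _ _).2 h⟩

theorem covered_smul {c : ℝ} (hc : 0 < c) (x : HSpace n) :
    (liftFamily Γ Δ).Covered (c • x.val) :=
  ⟨smul_ne_zero hc.ne' x.val_ne_zero, by rw [support_smul hc]; exact (hS.covered x).2⟩

theorem faceOf_pos_smul {c : ℝ} (hc : 0 < c) (x : HSpace n) :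
    (liftFamily Γ Δ).FaceOf (c • x.val) x.val ∧ (liftFamily Γ Δ).FaceOf x.val (c • x.val) := by
  have := (FaceOf.zero (C := liftFamily Γ Δ) x.val).smul_add (hS.covered x) hc
  rw [add_zero] at this
  exact ⟨this.1, this.2.1⟩

/-- No nontrivial element maps a cell to itself, because a cell lies in a simplex of diameter at
most ρ. Hence translating one point per orbit of cells puts exactly one centre in each cell. -/
theorem eq_of_sameCell_smul {γ γ' : Γ} {x : HSpace n} (h : SameCell Γ Δ (γ • x) (γ' • x)) :
    γ = γ' := by
  obtain ⟨l, hl⟩ := (hS.covered (γ • x)).2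
  have hl' := hl
  rw [h.support_eq] at hl'
  rw [mem_support_iff] at hl hl'
  exact hS.eq_of_dist_lt (x := x) (by linarith [hS.dist_le hl hl', hS.pos])

theorem finite_near (x : HSpace n) : ((liftFamily Γ Δ).near x.val).Finite :=
  Set.Finite.of_finite_image (f := Prod.snd) (Set.toFinite _)
    fun _ hl _ hl' h => hS.near_unique hl hl' h

theorem locallyFinite (v : Minkowski n) (hv : (liftFamily Γ Δ).Covered v) :
    ∃ U ∈ 𝓝 v, (∀ u ∈ U, (liftFamily Γ Δ).Covered u) ∧
      (⋃ u ∈ U, (liftFamily Γ Δ).support u).Finite := by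
  obtain ⟨c, hc, x, rfl⟩ := exists_smul_val hv
  have hl : Continuous fun u : Minkowski n => lorentz u u :=
    continuous_lorentz.comp (by fun_prop : Continuous fun u : Minkowski n => (u, u))
  have hlx : Continuous fun u : Minkowski n => lorentz u x.val :=
    continuous_lorentz.comp (by fun_prop : Continuous fun u : Minkowski n => (u, x.val))
  -- The future timelike vectors whose radial projection is at distance less than ρ from `x`,
  -- written without the projection so that openness is evident.
  let U : Set (Minkowski n) := {u | 0 < lorentz u u} ∩ {u | 0 < u.1} ∩
    {u | lorentz u x.val < Real.cosh ρ * √(lorentz u u)}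
  have hU : IsOpen U := ((isOpen_lt continuous_const hl).inter
    (isOpen_lt continuous_const continuous_fst)).inter
    (isOpen_lt hlx (continuous_const.mul hl.sqrt))
  have hself : lorentz (c • x.val) (c • x.val) = c ^ 2 := by
    rw [lorentz_smul_left, lorentz_smul_right, x.lorentz_self]; ring
  have hdist : ∀ u ∈ U, ∃ d : ℝ, 0 < d ∧ ∃ y : HSpace n, u = d • y.val ∧ dist y x < ρ := by
    rintro u ⟨⟨h1, h2⟩, h3⟩
    have hd : 0 < √(lorentz u u) := Real.sqrt_pos.2 h1
    refine ⟨_, hd, normalize u h1 h2, ?_, ?_⟩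
    · simp only [normalize, smul_smul, mul_inv_cancel₀ hd.ne', one_smul]
    · have h4 : Real.cosh (dist (normalize u h1 h2) x) < Real.cosh ρ := by
        rw [HSpace.cosh_dist]
        simp only [normalize, lorentz_smul_left]
        rw [inv_mul_lt_iff₀ hd, mul_comm]
        exact h3
      rwa [Real.cosh_lt_cosh, abs_of_nonneg dist_nonneg, abs_of_pos hS.pos] at h4
  refine ⟨U, hU.mem_nhds ⟨⟨?_, mul_pos hc x.time_pos⟩, ?_⟩, fun u hu => ?_, ?_⟩
  · change 0 < lorentz (c • x.val) (c • x.val)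
    rw [hself]; positivity
  · change lorentz (c • x.val) x.val < Real.cosh ρ * √(lorentz (c • x.val) (c • x.val))
    rw [hself, lorentz_smul_left, x.lorentz_self, Real.sqrt_sq hc.le]
    nlinarith [Real.one_lt_cosh.2 hS.pos.ne']
  · obtain ⟨d, hd, y, rfl, -⟩ := hdist u hu
    exact hS.covered_smul hd y
  · refine Set.Finite.of_finite_image (f := Prod.snd) (Set.toFinite _) fun l hl l' hl' h => ?_
    simp only [Set.mem_iUnion] at hl hl'
    obtain ⟨u, hu, hlu⟩ := hl
    obtain ⟨u', hu', hlu'⟩ := hl'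
    obtain ⟨d, hd, y, rfl, hy⟩ := hdist u hu
    obtain ⟨d', hd', y', rfl, hy'⟩ := hdist u' hu'
    rw [support_smul hd, mem_support_iff] at hlu
    rw [support_smul hd', mem_support_iff] at hlu'
    exact hS.lift_unique h hlu hlu' (by linarith [dist_triangle_right y y' x, hS.pos])

theorem eq_of_mem_centers {x y : HSpace n} (hx : x.val ∈ centers Γ Δ) (hy : y.val ∈ centers Γ Δ)
    (h : SameCell Γ Δ x y) : x = y := by
  obtain ⟨γ, q, hq⟩ := hx
  obtain ⟨γ', q', hq'⟩ := hy
  obtain rfl := HSpace.ext hq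
  obtain rfl := HSpace.ext hq'
  have hqq : q = q' := by
    rw [← q.out_eq, ← q'.out_eq]
    refine Quotient.sound ⟨γ'⁻¹ * γ, ?_⟩
    rw [mul_smul]
    simpa using h.smul γ'⁻¹
  subst hqq
  rw [hS.eq_of_sameCell_smul h]

theorem code_near {x : HSpace n} {l : Γ × Fin T} (hl : l ∈ (liftFamily Γ Δ).near x.val)
    (k : Fin (n + 1)) :
    (code Γ Δ x.val).2 l.2 k = SignType.sign ((liftFamily Γ Δ).coord l k x.val) := by
  have h : ∃ γ : Γ, (γ, l.2) ∈ (liftFamily Γ Δ).near x.val := ⟨l.1, hl⟩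
  have : (h.choose, l.2) = l := hS.near_unique h.choose_spec hl rfl
  simp only [code, dif_pos h, this]

/-- The code forgets group elements. For two points of one translate nothing is lost: they are at
most ρ apart, so the translates of a given simplex that contain them coincide. Thus the supports
agree, then the nearby cones, then the signs. -/
theorem sameCell_of_code {l : Γ × Fin T} {x y : HSpace n}
    (hx : l ∈ (liftFamily Γ Δ).support x.val) (hy : l ∈ (liftFamily Γ Δ).support y.val)
    (h : code Γ Δ x.val = code Γ Δ y.val) : SameCell Γ Δ x y := by
  have hsub : ∀ x y : HSpace n, l ∈ (liftFamily Γ Δ).support x.val →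
      l ∈ (liftFamily Γ Δ).support y.val → code Γ Δ x.val = code Γ Δ y.val →
      (liftFamily Γ Δ).support x.val ⊆ (liftFamily Γ Δ).support y.val := by
    intro x y hx hy h m hm
    have hj : m.2 ∈ (code Γ Δ x.val).1 := ⟨m.1, hm⟩
    rw [h] at hj
    obtain ⟨γ, hγ⟩ := hj
    rw [mem_support_iff] at hx hy hm
    have hγ' := (mem_support_iff _ _).1 hγ
    have := hS.lift_unique (l := m) (l' := (γ, m.2)) rfl hm hγ'
      (by linarith [hS.dist_le hx hy, hS.pos])
    rw [this]; exact hγ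
  have hsupp := (hsub x y hx hy h).antisymm (hsub y x hy hx h.symm)
  have hnear : (liftFamily Γ Δ).near x.val = (liftFamily Γ Δ).near y.val :=
    (near_mono hsupp.subset).antisymm (near_mono hsupp.superset)
  have hsign : ∀ m ∈ (liftFamily Γ Δ).near x.val, ∀ k,
      SignType.sign ((liftFamily Γ Δ).coord m k x.val) =
        SignType.sign ((liftFamily Γ Δ).coord m k y.val) := by
    intro m hm k
    rw [← hS.code_near hm, ← hS.code_near (hnear ▸ hm), h]
  have aux : ∀ a b : ℝ, SignType.sign a = SignType.sign b →
      (a = 0 → b = 0) ∧ (0 < a → 0 ≤ b) ∧ (a < 0 → b ≤ 0) := by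
    intro a b hab
    refine ⟨fun h => ?_, fun h => ?_, fun h => ?_⟩
    · rw [h, sign_zero, eq_comm, sign_eq_zero_iff] at hab; exact hab
    · rw [sign_pos h, eq_comm, sign_eq_one_iff] at hab; exact hab.le
    · rw [sign_neg h, eq_comm, sign_eq_neg_one_iff] at hab; exact hab.le
  exact ⟨fun m hm k => aux _ _ (hsign m (hnear ▸ hm) k).symm, fun m hm k => aux _ _ (hsign m hm k)⟩

theorem code_injOn (l : Γ × Fin T) :
    Set.InjOn (code Γ Δ) {y ∈ centers Γ Δ | l ∈ (liftFamily Γ Δ).support y} := by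
  rintro v ⟨hv, hlv⟩ w ⟨hw, hlw⟩ h
  obtain ⟨γ, q, rfl⟩ := id hv
  obtain ⟨γ', q', rfl⟩ := id hw
  rw [hS.eq_of_mem_centers hv hw (hS.sameCell_of_code hlv hlw h)]

theorem isCentered : (liftFamily Γ Δ).IsCentered (centers Γ Δ) where
  covered := by
    rintro _ ⟨γ, q, rfl⟩
    exact hS.covered _
  exists_center v hv := by
    obtain ⟨c, hc, x, rfl⟩ := exists_smul_val hv
    obtain ⟨γ, hγ⟩ := Quotient.exact ((Quotient.mk (cellSetoid Γ Δ) x).out_eq)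
    obtain ⟨h1, h2⟩ := hS.faceOf_pos_smul hc x
    exact ⟨_, ⟨γ, _, rfl⟩, hγ.1.trans h2 hv.1, h1.trans hγ.2 (HSpace.val_ne_zero _)⟩
  eq_of_faceOf := by
    rintro v hv w hw h1 h2
    obtain ⟨γ, q, rfl⟩ := id hv
    obtain ⟨γ', q', rfl⟩ := id hw
    rw [hS.eq_of_mem_centers hv hw ⟨h1, h2⟩]
  finite_near v hv := by
    obtain ⟨c, hc, x, rfl⟩ := exists_smul_val hv
    refine (hS.finite_near x).subset (near_mono ?_)
    rw [support_smul hc]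
  locallyFinite := hS.locallyFinite
  finite_centers l := Set.Finite.of_finite_image (Set.toFinite _) (hS.code_injOn l)

theorem ncard_centers_le (l : Γ × Fin T) :
    {y ∈ centers Γ Δ | l ∈ (liftFamily Γ Δ).support y}.ncard ≤ 2 ^ T * 3 ^ (T * (n + 1)) := by
  rw [← (hS.code_injOn l).ncard_image]
  refine (Set.ncard_le_ncard (Set.subset_univ _)).trans ?_
  rw [Set.ncard_univ, Nat.card_prod, Nat.card_fun]
  simp only [Nat.card_eq_fintype_card, Fintype.card_set, Fintype.card_fin, Fintype.card_fun]
  have : Fintype.card SignType = 3 := rfl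
  rw [this, ← pow_mul, mul_comm T (n + 1)]

end SmallCover

end Hyperbolic
end

/-! ### The action on flags and the triangulation of the quotient. -/

noncomputable section
namespace Hyperbolic
open Topology
variable {n T : ℕ} {Γ : Type*} [Group Γ] [MulAction Γ (HSpace n)] [IsIsometricSMul Γ (HSpace n)]
variable {Δ : Fin T → GeodesicSimplex n} {ρ : ℝ}
open ConeFamily

/-- The injective linear map that extends `γ` permutes the coordinates of the family, so it carries
the span of a cell into the span of the translated cell. -/
theorem rank_le_rank_smul (γ : Γ) (x : HSpace n) :
    (liftFamily Γ Δ).rank x.val ≤ (liftFamily Γ Δ).rank (γ • x).val := by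
  rcases isEmpty_or_nonempty (Fin T) with hT | ⟨⟨j⟩⟩
  · refine Submodule.finrank_mono fun u _ l => (hT.false l.2).elim
  obtain ⟨A, hA⟩ := exists_linearMap (Δ j) γ
  have hcoord : ∀ (l : Γ × Fin T) k v, (liftFamily Γ Δ).coord l k (A v) =
      (liftFamily Γ Δ).coord (γ⁻¹ * l.1, l.2) k v := by
    intro l k v
    have h := ((Δ l.2).translate (γ⁻¹ * l.1)).repr_translate hA v k
    rw [← GeodesicSimplex.translate_mul, mul_inv_cancel_left] at h
    exact h
  have hinj : Function.Injective A := by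
    rw [injective_iff_map_eq_zero]
    intro v hv
    refine (liftFamily Γ Δ).pointed (1, j) v fun k => ?_
    have h := hcoord (γ, j) k v
    rwa [hv, map_zero, inv_mul_cancel, eq_comm] at h
  have hmap : ((liftFamily Γ Δ).cellSpan x.val).map A ≤ (liftFamily Γ Δ).cellSpan (γ • x).val := by
    rintro _ ⟨u, hu, rfl⟩ l hl k hz
    rw [hcoord]
    exact hu _ (mem_near_smul γ l x hl) k (by rwa [← coord_smul])
  rw [rank, (Submodule.equivMapOfInjective A hinj _).finrank_eq]
  exact Submodule.finrank_mono hmap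

theorem rank_smul (γ : Γ) (x : HSpace n) :
    (liftFamily Γ Δ).rank (γ • x).val = (liftFamily Γ Δ).rank x.val := by
  refine le_antisymm ?_ (rank_le_rank_smul γ x)
  have := rank_le_rank_smul (Δ := Δ) γ⁻¹ (γ • x)
  rwa [inv_smul_smul] at this

variable (Γ Δ) in
/-- The flags of cells of the arrangement of the translates. -/
abbrev LiftFlag : Type := (liftFamily Γ Δ).Flag (centers Γ Δ) n

namespace LiftFlag

theorem exists_point (F : LiftFlag Γ Δ) (k : Fin (n + 1)) : ∃ x : HSpace n, x.val = F.vertex k := by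
  obtain ⟨γ, q, h⟩ := F.mem k
  exact ⟨_, h.symm⟩

/-- The vertices of a flag as points of hyperbolic space. -/
def point (F : LiftFlag Γ Δ) (k : Fin (n + 1)) : HSpace n := (exists_point F k).choose

theorem point_val (F : LiftFlag Γ Δ) (k : Fin (n + 1)) : (point F k).val = F.vertex k :=
  (exists_point F k).choose_spec

instance : MulAction Γ (LiftFlag Γ Δ) where
  smul γ F :=
    { vertex := fun k => (γ • point F k).val
      mem := fun k => smul_mem_centers γ (by rw [point_val]; exact F.mem k)
      faceOf := fun k l h => faceOf_smul γ (by rw [point_val, point_val]; exact F.faceOf k l h)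
      rank := fun k => by rw [rank_smul, point_val, F.rank] }
  one_smul F := ConeFamily.Flag.ext (funext fun k => by
    change ((1 : Γ) • point F k).val = _
    rw [one_smul, point_val])
  mul_smul γ γ' F := ConeFamily.Flag.ext (funext fun k => by
    change ((γ * γ') • point F k).val = (γ • point _ k).val
    rw [mul_smul]
    congr 2
    refine HSpace.ext ?_
    rw [point_val]; rfl)

theorem smul_vertex (γ : Γ) (F : LiftFlag Γ Δ) (k : Fin (n + 1)) :
    (γ • F).vertex k = (γ • point F k).val := rfl

theorem point_smul (γ : Γ) (F : LiftFlag Γ Δ) (k : Fin (n + 1)) :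
    point (γ • F) k = γ • point F k := HSpace.ext (by rw [point_val, smul_vertex])

theorem point_eq {F G : LiftFlag Γ Δ} {k : Fin (n + 1)} (h : F.vertex k = G.vertex k) :
    point F k = point G k := HSpace.ext (by rw [point_val, point_val, h])

theorem agreeOff_smul (γ : Γ) {F G : LiftFlag Γ Δ} {k : Fin (n + 1)} (h : Flag.AgreeOff k F G) :
    Flag.AgreeOff k (γ • F) (γ • G) := fun l hl => by
  rw [smul_vertex, smul_vertex, point_eq (h l hl)]

variable (hS : SmallCover Γ Δ ρ)

/-- The geodesic simplex spanned by a flag. -/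
def toSimplex (F : LiftFlag Γ Δ) : GeodesicSimplex n where
  vertex := point F
  linearIndependent := by
    simp only [point_val]
    exact F.linearIndependent hS.isCentered

theorem toSimplex_smul (γ : Γ) (F : LiftFlag Γ Δ) :
    toSimplex hS (γ • F) = (toSimplex hS F).translate γ := by
  simp only [toSimplex, GeodesicSimplex.translate]
  congr 1
  exact funext (point_smul γ F)

theorem param_smul (γ : Γ) (F : LiftFlag Γ Δ) (t : stdSimplex ℝ (Fin (n + 1))) :
    (toSimplex hS (γ • F)).param t = γ • (toSimplex hS F).param t := by
  rw [toSimplex_smul, GeodesicSimplex.translate_param]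

theorem exists_param_val (F : LiftFlag Γ Δ) (t : stdSimplex ℝ (Fin (n + 1))) :
    ∃ c : ℝ, 0 < c ∧ ((toSimplex hS F).param t).val = F.comb (c • t.1) := by
  obtain ⟨c, hc, h⟩ := (toSimplex hS F).exists_param_val t
  refine ⟨c, hc, ?_⟩
  rw [h, Flag.comb_smul, Flag.comb]
  simp only [toSimplex, point_val]

theorem param_mem_cone (F : LiftFlag Γ Δ) (t : stdSimplex ℝ (Fin (n + 1))) :
    ((toSimplex hS F).param t).val ∈ F.cone := by
  obtain ⟨c, hc, h⟩ := exists_param_val hS F t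
  exact ⟨_, fun k => mul_nonneg hc.le (t.2.1 k), h⟩

theorem param_congr {F G : LiftFlag Γ Δ} {t : stdSimplex ℝ (Fin (n + 1))}
    (h : ∀ k, t.1 k ≠ 0 → F.vertex k = G.vertex k) :
    (toSimplex hS F).param t = (toSimplex hS G).param t := by
  obtain ⟨c, hc, h1⟩ := exists_param_val hS F t
  obtain ⟨d, hd, h2⟩ := exists_param_val hS G t
  refine HSpace.eq_of_val_eq_smul (div_pos hc hd) ?_
  rw [h1, h2, Flag.comb_smul, Flag.comb_smul, smul_smul, div_mul_cancel₀ _ hd.ne',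
    Flag.comb_congr h]

/-- Uniqueness of combinations makes `t` and `s` proportional, and both have sum 1. -/
theorem param_inj {F G : LiftFlag Γ Δ} {t s : stdSimplex ℝ (Fin (n + 1))}
    (h : (toSimplex hS F).param t = (toSimplex hS G).param s) : t = s := by
  obtain ⟨c, hc, h1⟩ := exists_param_val hS F t
  obtain ⟨d, hd, h2⟩ := exists_param_val hS G s
  have heq : c • t.1 = d • s.1 := (Flag.comb_unique hS.isCentered F G
    (t := c • t.1) (s := d • s.1) (fun k => mul_nonneg hc.le (t.2.1 k)) (fun k => mul_nonneg hd.le (s.2.1 k))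
    (by rw [← h1, ← h2, h])).1
  have hk : ∀ k, c * t.1 k = d * s.1 k := fun k => congrFun heq k
  have hcd : c = d := by
    have := Finset.sum_congr (rfl : Finset.univ = Finset.univ) fun k _ => hk k
    rwa [← Finset.mul_sum, ← Finset.mul_sum, t.2.2, s.2.2, mul_one, mul_one] at this
  refine Subtype.ext (funext fun k => mul_left_cancel₀ hc.ne' ?_)
  rw [hk k, hcd]

theorem vertex_eq_of_mem_cone {F G H : LiftFlag Γ Δ} {t : stdSimplex ℝ (Fin (n + 1))}
    (hG : ((toSimplex hS F).param t).val ∈ G.cone) (hH : ((toSimplex hS F).param t).val ∈ H.cone)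
    {k : Fin (n + 1)} (hk : t.1 k ≠ 0) : G.vertex k = H.vertex k := by
  obtain ⟨c, hc, h⟩ := exists_param_val hS F t
  rw [h] at hG hH
  have hck : (c • t.1) k ≠ 0 := mul_ne_zero hc.ne' hk
  have h0 : ∀ k, 0 ≤ (c • t.1) k := fun k => mul_nonneg hc.le (t.2.1 k)
  obtain ⟨u, hu, hu'⟩ := hG
  obtain ⟨w, hw, hw'⟩ := hH
  rw [← (Flag.comb_unique hS.isCentered F G h0 hu hu').2 k hck,
    (Flag.comb_unique hS.isCentered F H h0 hw hw').2 k hck]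

theorem exists_eq_param {x : HSpace n} {F : LiftFlag Γ Δ} (h : x.val ∈ F.cone) :
    ∃ t, (toSimplex hS F).param t = x := by
  obtain ⟨u, hu, hx⟩ := h
  have : x ∈ (toSimplex hS F).carrier := by
    rw [GeodesicSimplex.mem_carrier_iff]
    intro k
    have h' : x.val = ∑ k, u k • ((toSimplex hS F).vertex k).val := by
      rw [hx, Flag.comb]; simp only [toSimplex, point_val]
    rw [h', GeodesicSimplex.repr_sum]
    exact hu k
  exact this

theorem exists_carrier_subset (F : LiftFlag Γ Δ) :
    ∃ l : Γ × Fin T, (toSimplex hS F).carrier ⊆ ((Δ l.2).translate l.1).carrier := by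
  obtain ⟨l, hl⟩ := (hS.isCentered.covered _ (F.mem (Fin.last n))).2
  refine ⟨l, ?_⟩
  rintro _ ⟨t, rfl⟩
  obtain ⟨c, hc, h⟩ := exists_param_val hS F t
  rw [← mem_support_iff, h]
  exact F.mem_support_comb (fun k => mul_nonneg hc.le (t.2.1 k))
    (F.mem_support_vertex hS.isCentered hl)

/-- A flag simplex lies in one translate, of diameter at most ρ, while nontrivial elements move
points by at least 4ρ. -/
theorem injOn_proj (F : LiftFlag Γ Δ) : Set.InjOn (proj Γ) (toSimplex hS F).carrier := by
  intro x hx y hy h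
  obtain ⟨l, hl⟩ := exists_carrier_subset hS F
  obtain ⟨γ, rfl⟩ := proj_eq_iff.1 h
  have h1 := hS.dist_le (hl hx) (hl hy)
  have : γ = 1 := hS.eq_of_dist_lt (x := y) (by rw [one_smul]; linarith [hS.pos])
  rw [this, one_smul]

theorem sameCell_of_mem_openCarrier {F : LiftFlag Γ Δ} {x : HSpace n}
    (hx : x ∈ (toSimplex hS F).openCarrier) : SameCell Γ Δ x (point F (Fin.last n)) := by
  obtain ⟨t, ht, rfl⟩ := hx
  obtain ⟨c, hc, h⟩ := exists_param_val hS F t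
  have := F.comb_equiv hS.isCentered (t := c • t.1) (fun k => mul_nonneg hc.le (t.2.1 k))
    (m := Fin.last n) (mul_pos hc (ht _)) fun k hk => absurd (Fin.le_last k) (not_le.2 hk)
  rw [SameCell, point_val, h]
  exact ⟨this.1, this.2.1⟩

include hS in
theorem eq_one_of_vertex_smul {γ : Γ} {F : LiftFlag Γ Δ} {k : Fin (n + 1)}
    (h : (γ • F).vertex k = F.vertex k) : γ = 1 := by
  refine hS.eq_of_dist_lt (x := point F k) ?_
  rw [one_smul, ← point_smul, point_eq h, dist_self]
  linarith [hS.pos]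

/-- The flag on the other side of the facet opposite to the vertex `k`. -/
def mate (hn : 1 ≤ n) (F : LiftFlag Γ Δ) (k : Fin (n + 1)) : LiftFlag Γ Δ :=
  (Flag.exists_mate hS.isCentered finrank_minkowski hn F k).choose

variable (hn : 1 ≤ n)

theorem mate_ne (F : LiftFlag Γ Δ) (k : Fin (n + 1)) : mate hS hn F k ≠ F :=
  (Flag.exists_mate hS.isCentered finrank_minkowski hn F k).choose_spec.1

theorem agreeOff_mate (F : LiftFlag Γ Δ) (k : Fin (n + 1)) : Flag.AgreeOff k F (mate hS hn F k) :=
  (Flag.exists_mate hS.isCentered finrank_minkowski hn F k).choose_spec.2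

theorem eq_mate {F G : LiftFlag Γ Δ} {k : Fin (n + 1)} (h : Flag.AgreeOff k F G) (hne : G ≠ F) :
    G = mate hS hn F k :=
  Flag.mate_unique hS.isCentered finrank_minkowski h (agreeOff_mate hS hn F k) hne.symm
    (mate_ne hS hn F k).symm

theorem mate_mate (F : LiftFlag Γ Δ) (k : Fin (n + 1)) : mate hS hn (mate hS hn F k) k = F :=
  (eq_mate hS hn (agreeOff_mate hS hn F k).symm (mate_ne hS hn F k).symm).symm

/-- Mates are chosen arbitrarily, yet their uniqueness makes the choice equivariant, so adjacency
descends to orbits. -/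
theorem mate_smul (γ : Γ) (F : LiftFlag Γ Δ) (k : Fin (n + 1)) :
    mate hS hn (γ • F) k = γ • mate hS hn F k :=
  (eq_mate hS hn (agreeOff_smul γ (agreeOff_mate hS hn F k))
    fun h => mate_ne hS hn F k ((MulAction.injective γ) h)).symm

end LiftFlag

theorem SameCell.mem_openCarrier {x y : HSpace n} (h : SameCell Γ Δ x y) {l : Γ × Fin T}
    (hx : x ∈ ((Δ l.2).translate l.1).openCarrier) :
    y ∈ ((Δ l.2).translate l.1).openCarrier := by
  rw [GeodesicSimplex.mem_openCarrier_iff] at hx ⊢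
  have hl : l ∈ (liftFamily Γ Δ).support x.val := fun k => (hx k).le
  intro k
  have h1 := (h.2 l (support_subset_near x.val_ne_zero hl) k).2.1 (hx k)
  refine lt_of_le_of_ne h1 fun h0 => ?_
  have h2 := (h.1 l (support_subset_near y.val_ne_zero (h.support_eq ▸ hl)) k).1 h0.symm
  exact (hx k).ne' h2

namespace SmallCover

variable (hS : SmallCover Γ Δ ρ)

theorem ncard_flags_le (hS : SmallCover Γ Δ ρ) (l : Γ × Fin T) :
    {F : LiftFlag Γ Δ | l ∈ (liftFamily Γ Δ).support (F.vertex (Fin.last n))}.ncard ≤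
      (2 ^ T * 3 ^ (T * (n + 1))) ^ (n + 1) := by
  have hfin := hS.isCentered.finite_centers l
  set Z := {y ∈ centers Γ Δ | l ∈ (liftFamily Γ Δ).support y} with hZ
  have hle : Z.ncard ≤ 2 ^ T * 3 ^ (T * (n + 1)) := hS.ncard_centers_le l
  have : Finite Z := hfin
  have h1 : Nat.card {F : LiftFlag Γ Δ | l ∈ (liftFamily Γ Δ).support (F.vertex (Fin.last n))} ≤
      Nat.card (Fin (n + 1) → Z) := by
    refine Nat.card_le_card_of_injective
      (fun F k => ⟨F.1.vertex k, F.1.mem k, F.1.mem_support_vertex hS.isCentered F.2 k⟩) ?_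
    intro F G h
    refine Subtype.ext (ConeFamily.Flag.ext (funext fun k => ?_))
    exact congrArg Subtype.val (congrFun h k)
  rw [Nat.card_coe_set_eq, Nat.card_fun, Nat.card_eq_fintype_card (α := Fin (n + 1)),
    Fintype.card_fin, Nat.card_coe_set_eq] at h1
  exact h1.trans (Nat.pow_le_pow_left hle _)

theorem finite_quotient_and_card_le (hS : SmallCover Γ Δ ρ) :
    Finite (MulAction.orbitRel.Quotient Γ (LiftFlag Γ Δ)) ∧
      Nat.card (MulAction.orbitRel.Quotient Γ (LiftFlag Γ Δ)) ≤
        T * (2 ^ T * 3 ^ (T * (n + 1))) ^ (n + 1) := by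
  let S (j : Fin T) : Set (LiftFlag Γ Δ) :=
    {F | ((1 : Γ), j) ∈ (liftFamily Γ Δ).support (F.vertex (Fin.last n))}
  have hfin : ∀ j, Finite (S j) := fun j => Flag.finite_setOf_mem_support hS.isCentered _
  let f : (Σ j, S j) → MulAction.orbitRel.Quotient Γ (LiftFlag Γ Δ) := fun a =>
    Quotient.mk _ a.2.1
  have hf : Function.Surjective f := by
    intro q
    induction q using Quotient.inductionOn with | _ F
    obtain ⟨⟨γ, j⟩, hl⟩ := (hS.isCentered.covered _ (F.mem (Fin.last n))).2
    -- Moving the flag by γ⁻¹ brings its last vertex into `Δ j` itself, so only flags in the T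
    -- original simplices need counting.
    refine ⟨⟨j, γ⁻¹ • F, ?_⟩, Quotient.sound ⟨γ⁻¹, rfl⟩⟩
    change _ ∈ (liftFamily Γ Δ).support _
    rw [LiftFlag.smul_vertex, mem_support_smul, LiftFlag.point_val]
    simpa using hl
  refine ⟨Finite.of_surjective f hf, (Nat.card_le_card_of_surjective f hf).trans ?_⟩
  rw [Nat.card_sigma]
  refine (Finset.sum_le_card_nsmul _ _ _ fun j _ => ?_).trans
    (by rw [Finset.card_univ, Fintype.card_fin, smul_eq_mul])
  rw [Nat.card_coe_set_eq]
  exact hS.ncard_flags_le _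

section Triangulation

variable {N : ℕ} (e : MulAction.orbitRel.Quotient Γ (LiftFlag Γ Δ) ≃ Fin N)

omit [IsIsometricSMul Γ (HSpace n)] in
theorem proj_smul (γ : Γ) (x : HSpace n) : proj Γ (γ • x) = proj Γ x :=
  proj_eq_iff.2 ⟨γ, rfl⟩

omit [IsIsometricSMul Γ (HSpace n)] in
theorem continuous_proj : Continuous (proj Γ : HSpace n → HypQuotient n Γ) :=
  continuous_quotient_mk'

/-- The index of the orbit of a flag. -/
def index (F : LiftFlag Γ Δ) : Fin N := e (Quotient.mk _ F)

/-- A representative of the orbit with a given index. -/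
def rep (i : Fin N) : LiftFlag Γ Δ := (e.symm i).out

theorem index_rep (i : Fin N) : index e (rep e i) = i := by
  rw [index, rep]
  simp

theorem index_smul (γ : Γ) (F : LiftFlag Γ Δ) : index e (γ • F) = index e F :=
  congrArg e (Quotient.sound ⟨γ, rfl⟩)

theorem exists_smul_rep (F : LiftFlag Γ Δ) : ∃ γ : Γ, γ • rep e (index e F) = F := by
  have : Quotient.mk (MulAction.orbitRel Γ (LiftFlag Γ Δ)) (rep e (index e F)) =
      Quotient.mk _ F := by
    rw [rep, index]
    simp
  exact Quotient.exact this.symm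

theorem index_mate_rep (hn : 1 ≤ n) (F : LiftFlag Γ Δ) (k : Fin (n + 1)) :
    index e (LiftFlag.mate hS hn (rep e (index e F)) k) = index e (LiftFlag.mate hS hn F k) := by
  obtain ⟨γ, hγ⟩ := exists_smul_rep e F
  conv_rhs => rw [← hγ, LiftFlag.mate_smul, index_smul]

/-- The gluing of the orbits of flags. -/
def gluing (hn : 1 ≤ n) : Gluing n N where
  adj f := index e (LiftFlag.mate hS hn (rep e f.1) f.2)
  -- Vertices are indexed by the dimension of their cell, and adjacent flags share all vertices of
  -- the facet with the same indices.
  glue _ := 1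
  mate_ne := by
    rintro ⟨i, k⟩ h
    have h1 : index e (LiftFlag.mate hS hn (rep e i) k) = i := congrArg Prod.fst h
    obtain ⟨γ, hγ⟩ := exists_smul_rep e (LiftFlag.mate hS hn (rep e i) k)
    rw [h1] at hγ
    obtain ⟨l, hl⟩ : ∃ l, l ≠ k := by
      have : Nontrivial (Fin (n + 1)) := Fin.nontrivial_iff_two_le.2 (by omega)
      exact exists_ne k
    -- If a flag and its mate were in one orbit, the element relating them would fix a vertex of the
    -- common facet, hence be trivial.
    have h2 : γ = 1 := LiftFlag.eq_one_of_vertex_smul hS (F := rep e i) (k := l)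
      (by rw [hγ]; exact (LiftFlag.agreeOff_mate hS hn _ k l hl).symm)
    rw [h2, one_smul] at hγ
    exact LiftFlag.mate_ne hS hn _ k hγ.symm
  adj_mate := by
    rintro ⟨i, k⟩
    simp only [Equiv.Perm.coe_one, id]
    rw [index_mate_rep, LiftFlag.mate_mate, index_rep]
  glue_mate _ := inv_one.symm

/-- The map from the gluing to the quotient manifold. -/
def realizationMap (hn : 1 ≤ n) : (hS.gluing e hn).Realization → HypQuotient n Γ :=
  Quot.lift (fun p => proj Γ ((LiftFlag.toSimplex hS (rep e p.1)).param p.2)) (by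
    rintro ⟨i, t⟩ ⟨j, s⟩ ⟨k, hk, hj, hts⟩
    obtain rfl : s = t := Subtype.ext (funext hts)
    change j = index e (LiftFlag.mate hS hn (rep e i) k) at hj
    subst hj
    obtain ⟨γ, hγ⟩ := exists_smul_rep e (LiftFlag.mate hS hn (rep e i) k)
    rw [← proj_smul γ ((LiftFlag.toSimplex hS (rep e (index e _))).param s),
      ← LiftFlag.param_smul, hγ]
    congr 1
    exact LiftFlag.param_congr hS fun l hl =>
      LiftFlag.agreeOff_mate hS hn _ k l (by rintro rfl; exact hl hk))

theorem continuous_realizationMap (hn : 1 ≤ n) : Continuous (hS.realizationMap e hn) := by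
  refine continuous_quot_lift _ ?_
  rw [continuous_prod_of_discrete_left]
  exact fun i => continuous_proj.comp (GeodesicSimplex.continuous_param (LiftFlag.toSimplex hS (rep e i)))

theorem surjective_realizationMap (hn : 1 ≤ n) :
    Function.Surjective (hS.realizationMap e hn) := by
  intro z
  induction z using Quotient.inductionOn with | _ x
  obtain ⟨F, hF⟩ := exists_mem_cone hS.isCentered finrank_minkowski (hS.covered x)
  obtain ⟨t, rfl⟩ := LiftFlag.exists_eq_param hS hF
  obtain ⟨γ, hγ⟩ := exists_smul_rep e F
  refine ⟨Quot.mk _ (index e F, t), ?_⟩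
  change proj Γ _ = proj Γ _
  rw [← proj_smul γ, ← LiftFlag.param_smul, hγ]

/-- Two points with the same image lift to one point `p`, with the same barycentric coordinates in
two flags. The flags are joined by a path in the star of `p`, and each step of the path is trivial
or a facet identification. -/
theorem injective_realizationMap (hn : 1 ≤ n) :
    Function.Injective (hS.realizationMap e hn) := by
  intro a b h
  induction a using Quot.ind with | _ a
  induction b using Quot.ind with | _ b
  obtain ⟨i, t⟩ := a
  obtain ⟨j, s⟩ := b
  obtain ⟨γ, hγ⟩ := proj_eq_iff.1 (show proj Γ ((LiftFlag.toSimplex hS (rep e i)).param t) =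
    proj Γ ((LiftFlag.toSimplex hS (rep e j)).param s) from h)
  rw [← LiftFlag.param_smul] at hγ
  obtain rfl := LiftFlag.param_inj hS hγ
  set p := ((LiftFlag.toSimplex hS (rep e i)).param s).val with hp
  have hi : p ∈ (rep e i).cone := LiftFlag.param_mem_cone hS _ _
  have hj : p ∈ (γ • rep e j).cone := by
    rw [hp, ← hγ]; exact LiftFlag.param_mem_cone hS _ _
  have hpath := Flag.reflTransGen_step hS.isCentered finrank_minkowski (hS.covered _) _ _ hi hj
  have key : ∀ G : LiftFlag Γ Δ, Relation.ReflTransGen (Flag.Step p) (rep e i) G →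
      Quot.mk (hS.gluing e hn).Identified (i, s) = Quot.mk _ (index e G, s) := by
    intro G hG
    induction hG with
    | refl => rw [index_rep]
    | tail _ hstep ih =>
      rename_i G H _
      rw [ih]
      obtain ⟨h1, h2, k, hk⟩ := hstep
      by_cases hGH : H = G
      · rw [hGH]
      refine Quot.sound ⟨k, ?_, ?_, fun m => rfl⟩
      · by_contra h0
        -- A nonzero coefficient at `k` would make the `k`-th vertices of the two flags agree as
        -- well, so the flags would be equal.
        exact hGH (hk.eq_of_vertex (LiftFlag.vertex_eq_of_mem_cone hS h1 h2 h0)).symm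
      · change index e H = index e (LiftFlag.mate hS hn (rep e (index e G)) k)
        rw [index_mate_rep, ← LiftFlag.eq_mate hS hn hk hGH]
  rw [key _ hpath, index_smul, index_rep]

variable [ProperlyDiscontinuousSMul Γ (HSpace n)]

/-- The geometric triangulation by the orbits of flags. -/
def triangulation (hn : 1 ≤ n) : GeometricTriangulation n Γ N where
  gluing := hS.gluing e hn
  homeo := (hS.continuous_realizationMap e hn).homeoOfEquivCompactToT2
    (f := Equiv.ofBijective _ ⟨hS.injective_realizationMap e hn, hS.surjective_realizationMap e hn⟩)
  simplex i := LiftFlag.toSimplex hS (rep e i)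
  homeo_mk _ _ := rfl
  embedded _ := LiftFlag.injOn_proj hS _

theorem triangulation_subset_or_disjoint (hn : 1 ≤ n) (i : Fin N) (j : Fin T) :
    proj Γ '' ((hS.triangulation e hn).simplex i).openCarrier ⊆ proj Γ '' (Δ j).openCarrier ∨
      Disjoint (proj Γ '' ((hS.triangulation e hn).simplex i).openCarrier)
        (proj Γ '' (Δ j).openCarrier) := by
  change proj Γ '' (LiftFlag.toSimplex hS (rep e i)).openCarrier ⊆ _ ∨
    Disjoint (proj Γ '' (LiftFlag.toSimplex hS (rep e i)).openCarrier) _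
  -- The interior of a flag simplex lies in the cell of its last vertex, and membership in an open
  -- translate is constant on cells, so the last vertex decides.
  by_cases h : ∃ γ : Γ, LiftFlag.point (rep e i) (Fin.last n) ∈ ((Δ j).translate γ).openCarrier
  · left
    obtain ⟨γ, hγ⟩ := h
    rintro _ ⟨x, hx, rfl⟩
    have := (LiftFlag.sameCell_of_mem_openCarrier hS hx).symm.mem_openCarrier (l := (γ, j)) hγ
    exact ⟨γ⁻¹ • x, (GeodesicSimplex.mem_openCarrier_translate _ _ _).1 this, proj_smul _ _⟩
  · right
    rw [Set.disjoint_left]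
    rintro _ ⟨x, hx, rfl⟩ ⟨y, hy, hxy⟩
    obtain ⟨γ, rfl⟩ := proj_eq_iff.1 hxy.symm
    exact h ⟨γ, (LiftFlag.sameCell_of_mem_openCarrier hS hx).mem_openCarrier (l := (γ, j))
      ((GeodesicSimplex.smul_mem_openCarrier_translate _ _ _).2 hy)⟩

end Triangulation

end SmallCover

theorem flag_count_le {n T : ℕ} (hn : 1 ≤ n) :
    T * (2 ^ T * 3 ^ (T * (n + 1))) ^ (n + 1) ≤ T * 2 ^ (T * 12 * n ^ 2) := by
  refine Nat.mul_le_mul_left T ?_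
  have h3 : 3 ^ (T * (n + 1)) ≤ 2 ^ (2 * (T * (n + 1))) := by
    exact (Nat.pow_le_pow_left (by norm_num : 3 ≤ 2 ^ 2) _).trans_eq (pow_mul 2 2 _).symm
  calc (2 ^ T * 3 ^ (T * (n + 1))) ^ (n + 1)
      ≤ (2 ^ T * 2 ^ (2 * (T * (n + 1)))) ^ (n + 1) :=
        Nat.pow_le_pow_left (Nat.mul_le_mul_left _ h3) _
    _ = 2 ^ ((T + 2 * (T * (n + 1))) * (n + 1)) := by rw [← pow_add, ← pow_mul]
    _ ≤ 2 ^ (T * 12 * n ^ 2) := by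
        refine Nat.pow_le_pow_right (by norm_num) ?_
        -- The left side is 2n² + 5n + 3, at most 10n² for n ≥ 1; the constant 12 leaves some room.
        have : (1 + 2 * (n + 1)) * (n + 1) ≤ 12 * n ^ 2 := by nlinarith
        calc (T + 2 * (T * (n + 1))) * (n + 1) = T * ((1 + 2 * (n + 1)) * (n + 1)) := by ring
          _ ≤ T * (12 * n ^ 2) := Nat.mul_le_mul_left _ this
          _ = T * 12 * n ^ 2 := by ring

end Hyperbolic
end
theorem mainTheorem8 :
    ∃ a : ℕ, ∀ (n : ℕ), 1 ≤ n →
      ∀ (Γ : Type*) [Group Γ] [MulAction Γ (Hyperbolic.HSpace n)]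
        [IsIsometricSMul Γ (Hyperbolic.HSpace n)]
        [IsCancelSMul Γ (Hyperbolic.HSpace n)]
        [ProperlyDiscontinuousSMul Γ (Hyperbolic.HSpace n)]
        [CompactSpace (Hyperbolic.HypQuotient n Γ)]
        (T : ℕ) (Δ : Fin T → Hyperbolic.GeodesicSimplex n),
        (⋃ j, Hyperbolic.proj Γ '' (Δ j).carrier) = Set.univ →
        (∀ j, Metric.ediam (Δ j).carrier ≤ Hyperbolic.injectivityRadius n Γ / 2) →
        ∃ N : ℕ, N ≤ T * 2 ^ (T * a * n ^ 2) ∧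
          ∃ 𝒯 : Hyperbolic.GeometricTriangulation n Γ N, ∀ (i : Fin N) (j : Fin T),
            Hyperbolic.proj Γ '' (𝒯.simplex i).openCarrier ⊆
                Hyperbolic.proj Γ '' (Δ j).openCarrier ∨
              Disjoint (Hyperbolic.proj Γ '' (𝒯.simplex i).openCarrier)
                (Hyperbolic.proj Γ '' (Δ j).openCarrier) := by
  refine ⟨12, fun n hn Γ _ _ _ _ _ _ T Δ hcov hdiam => ?_⟩
  obtain ⟨ρ, hS⟩ := Hyperbolic.exists_smallCover hn Δ hcov hdiam
  obtain ⟨hfin, hcard⟩ := hS.finite_quotient_and_card_le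
  exact ⟨_, hcard.trans (Hyperbolic.flag_count_le hn), hS.triangulation (Finite.equivFin _) hn,
    hS.triangulation_subset_or_disjoint _ hn⟩
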